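/- Let $n\ge 2$, let $P$ be an irreducible transition probability matrix on $[n]=\{1,\dots,n\}$ with stationary distribution $\pi$, let $\Pi=\mathrm{diag}(\pi_1,\dots,\pi_n)$, and let $Q=\Pi(P-I)$. Fix a state $a\in[n]$, and let $(X_t)_{t\ge 0}$ be the (right-continuous) continuous-time Markov chain on $[n]$ with rate matrix $Q$ started at $X_0=a$. For $i\in[n]$ and $t\ge0$ let \[\mathcal L_t^i=\int_0^t \mathbf 1\{X_s=i\}\,ds,\] and for $r\ge 0$ let $\tau_{\mathrm{inv}}(r)=\inf\{t\ge 0:\mathcal L_t^a>r\}$. Let $Q_{**}$ be the matrix obtained from $Q$ by deleting the row and the column of $a$, let $\tilde G=(-Q_{**})^{-1}$ and $S_{**}=\frac12(Q_{**}+Q_{**}^T)$, let $\sigma\ge 0$ be such that $\sigma^2$ is the largest diagonal entry of $\frac12(-S_{**})^{-1}$, and let \[\gamma=\frac{\det(2\tilde G)}{\det(\tilde G+\tilde G^T)}.\] Then, for every $r\ge 0$, $\tau_{\mathrm{inv}}(r)<\infty$ almost surely, and for every $\lambda>0$ \[\mathbb P\bigg(\Big(\sum_{i=1}^n\pi_i\,\mathcal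 L^i_{\tau_{\mathrm{inv}}(r)}\Big)^{1/2}-\sqrt r\ \ge\ \sqrt\lambda\,\sigma\bigg)\le 5\,\gamma\,e^{-\lambda/8}.\] -/

import Mathlib

open MeasureTheory
open scoped NNReal

namespace TailBound

variable {V : Type*} [Fintype V] [DecidableEq V]

/-- `π` is a stationary distribution of the transition matrix `P`: a probability vector
with `π P = π`. -/
structure IsStationary (P : Matrix V V ℝ) (π : V → ℝ) : Prop where
  nonneg : ∀ i, 0 ≤ π i
  sum_eq_one : ∑ i, π i = 1
  invariant : Matrix.vecMul π P = π

/-- The normalized Laplacian `Q = Π (P - I)`, with `Π` the diagonal matrix of `π`. -/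
def laplacian (P : Matrix V V ℝ) (π : V → ℝ) : Matrix V V ℝ :=
  Matrix.diagonal π * (P - 1)

/-- The block `M_**` of `M`: the row and the column of the state `a` are removed. -/
def removeState (M : Matrix V V ℝ) (a : V) : Matrix {i // i ≠ a} {i // i ≠ a} ℝ :=
  M.submatrix Subtype.val Subtype.val

/-- The Green's kernel `(-Q_**)⁻¹` of the chain killed upon hitting `a`. -/
noncomputable def green (Q : Matrix V V ℝ) (a : V) : Matrix {i // i ≠ a} {i // i ≠ a} ℝ :=
  (-removeState Q a)⁻¹

/-- The symmetric part `S_** = (Q_** + Q_**ᵀ) / 2`. -/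
noncomputable def symPart (Q : Matrix V V ℝ) (a : V) : Matrix {i // i ≠ a} {i // i ≠ a} ℝ :=
  (1 / 2 : ℝ) • (removeState Q a + (removeState Q a).transpose)

/-- `σ²`, the largest diagonal entry of `(1/2) (-S_**)⁻¹`. -/
noncomputable def sigmaSq (Q : Matrix V V ℝ) (a : V) : ℝ :=
  ⨆ i : {i // i ≠ a}, ((1 / 2 : ℝ) • (-symPart Q a)⁻¹) i i

/-- `γ = det (2 G) / det (G + Gᵀ)` for the Green's kernel `G = (-Q_**)⁻¹`. -/
noncomputable def gammaRatio (Q : Matrix V V ℝ) (a : V) : ℝ :=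
  ((2 : ℝ) • green Q a).det / (green Q a + (green Q a).transpose).det

/-- `X` is, under `μ`, a continuous-time Markov chain on the finite set `V` with rate matrix `Q`
started at `a`: its paths are right-continuous (for the discrete topology on `V`), it starts
at `a` almost surely, and its finite-dimensional distributions are those of the transition
semigroup `t ↦ exp (t Q)`. -/
structure IsMarkovChain {Ω : Type*} [MeasurableSpace Ω] (μ : Measure Ω)
    (Q : Matrix V V ℝ) (a : V) (X : ℝ≥0 → Ω → V) : Prop where
  measurableSet_eq : ∀ t i, MeasurableSet {ω | X t ω = i}
  rightContinuous : ∀ ω t, ∀ᶠ s in nhdsWithin t (Set.Ici t), X s ω = X t ω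
  start : ∀ᵐ ω ∂μ, X 0 ω = a
  finiteDimensional : ∀ (m : ℕ) (t : Fin (m + 1) → ℝ≥0), Monotone t → ∀ x : Fin (m + 1) → V,
    μ.real {ω | ∀ k, X (t k) ω = x k} =
      μ.real {ω | X (t 0) ω = x 0} *
        ∏ k : Fin m, NormedSpace.exp (((t k.succ : ℝ) - (t k.castSucc : ℝ)) • Q)
          (x k.castSucc) (x k.succ)

/-- The local time `L_t^i = ∫_0^t 1{X_s = i} ds`. -/
noncomputable def localTime {Ω : Type*} (X : ℝ≥0 → Ω → V) (i : V) (t : ℝ) (ω : Ω) : ℝ :=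
  ∫ s in (0 : ℝ)..t, if X s.toNNReal ω = i then 1 else 0

/-- The inverse local time `τ_inv(r) = inf {t ≥ 0 : L_t^a > r}` at the state `a`. -/
noncomputable def invLocalTime {Ω : Type*} (X : ℝ≥0 → Ω → V) (a : V) (r : ℝ) (ω : Ω) : ℝ :=
  sInf {t : ℝ | 0 ≤ t ∧ r < localTime X a t ω}

end TailBound

/-! The bound holds with $e^{-\lambda/8}$ alone, and the prefactor is harmless because $\gamma\ge1$.
Write $v=\sigma^2$ and $A=-Q_{**}$. Reproducing-kernel Cauchy–Schwarz for the energy $x\cdot Ax$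
gives $x_i^2\le 2v\,(x\cdot Ax)$, hence the Poincaré inequality $\sum\pi_i x_i^2\le 2v\,(x\cdot Ax)$
for functions vanishing at $a$ (`sum_mul_sq_le_sigmaSq`).

So for $2v\theta<1$ the operator $A-\theta\Pi$ off $a$ is coercive and inverse nonnegative, and
there are $h\ge1$ with $h(a)=1$ and $\beta\le\theta/(1-2v\theta)$ solving $Qh+(\theta\pi-\beta
1_a)h=0$ (`exists_feynmanKac_solution`). Then $h(X_t)\exp(\theta\sum_i\pi_i\mathcal
L^i_t-\beta\mathcal L^a_t)$ should be a nonnegative martingale started from $1$. Lowering $\theta$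
by $\varepsilon$ makes it a strict supermartingale, and a maximal inequality, proved on discrete
skeletons and passed to the limit, bounds the probability that the exponent ever exceeds $u$ by
$e^{-u}$.

At $\tau_{\mathrm{inv}}(r)$ one has $\mathcal L^a\le r$, and a suitable $\theta$ gives the tail
(`chernoff_exponent`). If $\mathcal L^a$ stayed below $r$ forever the exponent would be unbounded,
whence finiteness. Finally $\gamma\ge1$ is the Ostrowski–Taussky inequality for the Green's kernel.
-/

section QuadraticForm

/-! ### Matrices with positive definite symmetric part -/

open Matrix
open scoped MatrixOrder

variable {ι : Type*} [Fintype ι] [DecidableEq ι]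

theorem Matrix.det_ne_zero_of_dotProduct_mulVec_pos {M : Matrix ι ι ℝ}
    (hM : ∀ x, x ≠ 0 → 0 < x ⬝ᵥ M *ᵥ x) : M.det ≠ 0 := by
  intro h
  obtain ⟨v, hv, hv0⟩ := exists_mulVec_eq_zero_iff.mpr h
  have := hM v hv
  simp [hv0] at this

omit [DecidableEq ι] in
theorem Matrix.dotProduct_self_pos_real {x : ι → ℝ} (hx : x ≠ 0) : 0 < x ⬝ᵥ x := by
  simpa using dotProduct_star_self_pos_iff.mpr hx

/-- The segment from $1$ to $M$ stays inside the convex set of such matrices, where the determinant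
never vanishes, so its sign is that of $\det 1$. -/
theorem Matrix.det_pos_of_dotProduct_mulVec_pos {M : Matrix ι ι ℝ}
    (hM : ∀ x, x ≠ 0 → 0 < x ⬝ᵥ M *ᵥ x) : 0 < M.det := by
  by_contra! hneg
  have hcont : Continuous fun t : ℝ => ((1 - t) • (1 : Matrix ι ι ℝ) + t • M).det := by
    apply Continuous.matrix_det
    fun_prop
  have h01 : (0 : ℝ) ∈ Set.Icc (((1 - (1 : ℝ)) • (1 : Matrix ι ι ℝ) + (1 : ℝ) • M).det)
      (((1 - (0 : ℝ)) • (1 : Matrix ι ι ℝ) + (0 : ℝ) • M).det) := by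
    simpa using hneg
  obtain ⟨t, ht, h0⟩ := intermediate_value_Icc' zero_le_one hcont.continuousOn h01
  refine det_ne_zero_of_dotProduct_mulVec_pos (fun x hx => ?_) h0
  have h1 := hM x hx
  have h2 := dotProduct_self_pos_real hx
  simp only [add_mulVec, smul_mulVec, one_mulVec, dotProduct_add, dotProduct_smul, smul_eq_mul]
  rcases eq_or_lt_of_le ht.1 with h | h
  · subst h
    simpa using h2
  · have : 0 ≤ (1 - t) * (x ⬝ᵥ x) := mul_nonneg (by linarith [ht.2]) h2.le
    have : 0 < t * (x ⬝ᵥ M *ᵥ x) := mul_pos h h1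
    linarith

theorem Matrix.PosSemidef.one_le_det_one_add {N : Matrix ι ι ℝ} (hN : N.PosSemidef) :
    1 ≤ (1 + N).det := by
  have hH : (1 + N).IsHermitian := isHermitian_one.add hN.1
  rw [hH.det_eq_prod_eigenvalues]
  have key : ∀ i, 1 ≤ hH.eigenvalues i := by
    intro i
    have hone := (isHermitian_one (n := ι) (α := ℝ)).add hN.1 |>.eigenvectorBasis.orthonormal.1 i
    rw [hH.eigenvalues_eq]
    set v : ι → ℝ := ⇑(hH.eigenvectorBasis i) with hv
    have hvv : star v ⬝ᵥ v = 1 := by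
      have : inner ℝ (hH.eigenvectorBasis i) (hH.eigenvectorBasis i) = (1 : ℝ) := by
        rw [real_inner_self_eq_norm_sq, hH.eigenvectorBasis.orthonormal.1 i]; norm_num
      rw [EuclideanSpace.inner_eq_star_dotProduct] at this
      rw [dotProduct_comm]
      exact this
    have h2 := hN.dotProduct_mulVec_nonneg v
    simp only [add_mulVec, one_mulVec, dotProduct_add, hvv]
    simpa using h2
  have : ∏ _i : ι, (1 : ℝ) ≤ ∏ i, hH.eigenvalues i :=
    Finset.prod_le_prod (fun _ _ => zero_le_one) fun i _ => key i
  simpa using this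

omit [DecidableEq ι] in
theorem Matrix.dotProduct_transpose_mulVec_self (M : Matrix ι ι ℝ) (x : ι → ℝ) :
    x ⬝ᵥ Mᵀ *ᵥ x = x ⬝ᵥ M *ᵥ x := by
  rw [mulVec_transpose, dotProduct_comm, ← dotProduct_mulVec]

/-- The Ostrowski–Taussky inequality. -/
theorem Matrix.det_add_transpose_le {M : Matrix ι ι ℝ}
    (hM : ∀ x, x ≠ 0 → 0 < x ⬝ᵥ M *ᵥ x) :
    0 < (M + Mᵀ).det ∧ (M + Mᵀ).det ≤ ((2 : ℝ) • M).det := by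
  have hS : (M + Mᵀ).PosDef := by
    refine PosDef.of_dotProduct_mulVec_pos ?_ fun x hx => ?_
    · rw [IsHermitian, conjTranspose_eq_transpose_of_trivial, transpose_add, transpose_transpose,
        add_comm]
    · have := hM x hx
      simp only [star_trivial, add_mulVec, dotProduct_add, dotProduct_transpose_mulVec_self]
      linarith
  refine ⟨hS.det_pos, ?_⟩
  obtain ⟨B, hB⟩ := CStarAlgebra.nonneg_iff_eq_star_mul_self.mp hS.posSemidef.nonneg
  rw [star_eq_conjTranspose, conjTranspose_eq_transpose_of_trivial] at hB
  have hdet : (M + Mᵀ).det = B.det * B.det := by rw [hB, det_mul, det_transpose]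
  have hB0 : IsUnit B.det := by
    refine isUnit_iff_ne_zero.mpr fun h => ?_
    have := hS.det_pos
    rw [hdet, h] at this
    simp at this
  -- Congruence by `B` turns the symmetric part of `2M` into the identity and the antisymmetric part
  -- into a skew matrix `K`.
  set K := (B⁻¹)ᵀ * (M - Mᵀ) * B⁻¹ with hK
  have hKt : Kᵀ = -K := by
    rw [hK]
    simp only [transpose_mul, transpose_transpose, transpose_sub]
    rw [← mul_assoc, ← neg_mul, ← mul_neg, neg_sub]
  have hBK : Bᵀ * (1 + K) * B = (2 : ℝ) • M := by
    have h1 : Bᵀ * (B⁻¹)ᵀ = 1 := by rw [← transpose_mul, nonsing_inv_mul _ hB0, transpose_one]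
    have h2 : B⁻¹ * B = 1 := nonsing_inv_mul _ hB0
    calc Bᵀ * (1 + K) * B = Bᵀ * B + (Bᵀ * (B⁻¹)ᵀ) * (M - Mᵀ) * (B⁻¹ * B) := by
          rw [hK]; noncomm_ring
      _ = (2 : ℝ) • M := by rw [h1, h2, ← hB, one_mul, mul_one, two_smul]; abel
  have hpos : 0 < (1 + K).det := by
    refine det_pos_of_dotProduct_mulVec_pos fun x hx => ?_
    have h1 : x ⬝ᵥ K *ᵥ x = 0 := by
      have := dotProduct_transpose_mulVec_self K x
      rw [hKt, neg_mulVec, dotProduct_neg] at this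
      linarith
    simpa [add_mulVec, h1] using dotProduct_self_pos_real hx
  have hsq : 1 ≤ (1 + K).det * (1 + K).det := by
    -- $\det(1+K)=\det(1-K)$ by transposition, and $(1-K)(1+K)=1+K^TK$.
    have h1 : (1 + K).det * (1 + K).det = (1 + Kᵀ * K).det := by
      nth_rewrite 1 [← det_transpose (1 + K)]
      rw [← det_mul, transpose_add, transpose_one, hKt]
      congr 1
      noncomm_ring
    rw [h1]
    exact PosSemidef.one_le_det_one_add (by
      simpa [conjTranspose_eq_transpose_of_trivial] using posSemidef_conjTranspose_mul_self K)
  have hge : 1 ≤ (1 + K).det := by nlinarith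
  rw [hdet, ← hBK, det_mul, det_mul, det_transpose]
  nlinarith [mul_self_nonneg B.det]

/-- A diagonal entry of the inverse of the symmetric part of a matrix controls the size of the
coordinates of a vector by its energy. -/
theorem Matrix.sq_apply_le_inv_mul_dotProduct_mulVec {S : Matrix ι ι ℝ} (hS : Sᵀ = S)
    (hpos : ∀ x, x ≠ 0 → 0 < x ⬝ᵥ S *ᵥ x) (x : ι → ℝ) (i : ι) :
    0 < S⁻¹ i i ∧ x i ^ 2 ≤ S⁻¹ i i * (x ⬝ᵥ S *ᵥ x) := by
  have hdet : IsUnit S.det := isUnit_iff_ne_zero.mpr (det_ne_zero_of_dotProduct_mulVec_pos hpos)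
  -- `u` represents evaluation at `i` for the form `S`, so the bound is Cauchy–Schwarz: the residual
  -- of `x` after projection onto `u` has nonnegative energy.
  set u : ι → ℝ := S⁻¹ *ᵥ Pi.single i 1 with hu
  have hSu : S *ᵥ u = Pi.single i 1 := by
    rw [hu, mulVec_mulVec, mul_nonsing_inv _ hdet, one_mulVec]
  have hui : u i = S⁻¹ i i := by simp [hu]
  have hu0 : u ≠ 0 := by
    intro h
    rw [h, mulVec_zero] at hSu
    have := congrFun hSu i
    simp at this
  have huu : u ⬝ᵥ S *ᵥ u = S⁻¹ i i := by rw [hSu, ← hui]; simp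
  have hxu : x ⬝ᵥ S *ᵥ u = x i := by rw [hSu]; simp
  have hux : u ⬝ᵥ S *ᵥ x = x i := by
    rw [dotProduct_mulVec, ← mulVec_transpose, hS, dotProduct_comm, hxu]
  have hK : 0 < S⁻¹ i i := huu ▸ hpos u hu0
  refine ⟨hK, ?_⟩
  have hnn : 0 ≤ (x - (x i / S⁻¹ i i) • u) ⬝ᵥ S *ᵥ (x - (x i / S⁻¹ i i) • u) := by
    rcases eq_or_ne (x - (x i / S⁻¹ i i) • u) 0 with h | h
    · simp [h]
    · exact (hpos _ h).le
  have hexp : (x - (x i / S⁻¹ i i) • u) ⬝ᵥ S *ᵥ (x - (x i / S⁻¹ i i) • u) =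
      x ⬝ᵥ S *ᵥ x - x i ^ 2 / S⁻¹ i i := by
    simp only [mulVec_sub, mulVec_smul, dotProduct_sub, sub_dotProduct, smul_dotProduct,
      dotProduct_smul, smul_eq_mul, huu, hxu, hux]
    field_simp
    ring
  rw [hexp, sub_nonneg, div_le_iff₀ hK] at hnn
  linarith

omit [DecidableEq ι] in
/-- A matrix with nonpositive off-diagonal entries and positive definite symmetric part is
inverse nonnegative. -/
theorem Matrix.nonneg_of_mulVec_nonneg {B : Matrix ι ι ℝ}
    (hpos : ∀ x, x ≠ 0 → 0 < x ⬝ᵥ B *ᵥ x) (hoff : ∀ i j, i ≠ j → B i j ≤ 0)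
    {y : ι → ℝ} (hy : ∀ i, 0 ≤ (B *ᵥ y) i) (i : ι) : 0 ≤ y i := by
  set m : ι → ℝ := fun i => max (-y i) 0 with hm
  set p : ι → ℝ := fun i => max (y i) 0 with hp
  have hyp : y = p - m := by
    funext j
    simp only [hp, hm, Pi.sub_apply]
    rcases le_total 0 (y j) with h | h
    · rw [max_eq_left h, max_eq_right (by linarith)]; ring
    · rw [max_eq_right h, max_eq_left (by linarith)]; ring
  -- Testing against the negative part `m`: the cross term with the positive part is nonpositive, as
  -- the supports are disjoint, so `m` has nonpositive energy and vanishes.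
  have h1 : 0 ≤ m ⬝ᵥ B *ᵥ y :=
    Finset.sum_nonneg fun j _ => mul_nonneg (le_max_right _ _) (hy j)
  have h2 : m ⬝ᵥ B *ᵥ p ≤ 0 := by
    simp only [dotProduct, mulVec, Finset.mul_sum]
    refine Finset.sum_nonpos fun j _ => Finset.sum_nonpos fun k _ => ?_
    have hmj : 0 ≤ m j := le_max_right _ _
    have hpk : 0 ≤ p k := le_max_right _ _
    rcases eq_or_ne j k with rfl | hjk
    · have : m j * p j = 0 := by
        simp only [hm, hp]
        rcases le_total 0 (y j) with h | h
        · rw [max_eq_right (by linarith : -y j ≤ 0), zero_mul]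
        · rw [max_eq_right h, mul_zero]
      exact le_of_eq (by rw [mul_left_comm, this, mul_zero])
    · nlinarith [mul_nonneg hmj hpk, hoff j k hjk]
  have hm0 : m = 0 := by
    by_contra h
    have := hpos m h
    rw [hyp, mulVec_sub, dotProduct_sub] at h1
    linarith
  have := congrFun hm0 i
  simp only [hm, Pi.zero_apply] at this
  have h3 : -y i ≤ max (-y i) 0 := le_max_left _ _
  linarith

end QuadraticForm

/-! ### Dirichlet form of the chain and the Feynman–Kac problem -/

namespace TailBound

open Matrix

variable {V : Type*} [Fintype V] [DecidableEq V]

omit [Fintype V] [DecidableEq V] in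
theorem forall_of_isIrreducible {P : Matrix V V ℝ} (hirr : P.IsIrreducible) {p : V → Prop}
    {i₀ : V} (h0 : p i₀) (hstep : ∀ i j, p i → 0 < P i j → p j) (j : V) : p j := by
  let : Quiver V := toQuiver P
  obtain ⟨q, -⟩ := hirr.connected i₀ j
  induction q with
  | nil => exact h0
  | cons _ e ih => exact hstep _ _ ih e.down

omit [DecidableEq V] in
theorem IsStationary.pos {P : Matrix V V ℝ} {π : V → ℝ} (hπ : IsStationary P π)
    (hirr : P.IsIrreducible) (i : V) : 0 < π i := by
  obtain ⟨i₀, h0⟩ : ∃ i, 0 < π i := by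
    by_contra! h
    have h1 : ∑ i, π i ≤ 0 := Finset.sum_nonpos fun i _ => h i
    have h2 := hπ.sum_eq_one
    linarith
  refine forall_of_isIrreducible hirr (p := fun i => 0 < π i) h0 (fun i j hi hij => ?_) i
  have hj : π j = ∑ k, π k * P k j := (congrFun hπ.invariant j).symm
  rw [hj]
  exact (mul_pos hi hij).trans_le
    (Finset.single_le_sum (f := fun k => π k * P k j)
      (fun k _ => mul_nonneg (hπ.nonneg k) (hirr.nonneg k j)) (Finset.mem_univ i))

theorem laplacian_apply (P : Matrix V V ℝ) (π : V → ℝ) (i j : V) :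
    laplacian P π i j = π i * (P i j - (1 : Matrix V V ℝ) i j) := by
  simp [laplacian, diagonal_mul]

theorem laplacian_mulVec (P : Matrix V V ℝ) (π z : V → ℝ) (i : V) :
    (laplacian P π *ᵥ z) i = π i * (∑ j, P i j * z j - z i) := by
  rw [laplacian, ← mulVec_mulVec, mulVec_diagonal, sub_mulVec, one_mulVec]
  rfl

theorem laplacian_sum_row {P : Matrix V V ℝ} (hP : P ∈ rowStochastic ℝ V) (π : V → ℝ) (i : V) :
    ∑ j, laplacian P π i j = 0 := by
  simp [laplacian_apply, ← Finset.mul_sum, sum_row_of_mem_rowStochastic hP, one_apply]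

theorem laplacian_sum_col {P : Matrix V V ℝ} {π : V → ℝ} (hπ : IsStationary P π) (j : V) :
    ∑ i, laplacian P π i j = 0 := by
  have hj : π j = ∑ k, π k * P k j := (congrFun hπ.invariant j).symm
  simp [laplacian_apply, mul_sub, Finset.sum_sub_distrib, ← hj, one_apply]

/-- The Dirichlet form of a chain. -/
theorem dotProduct_laplacian_mulVec {P : Matrix V V ℝ} (hP : P ∈ rowStochastic ℝ V)
    {π : V → ℝ} (hπ : IsStationary P π) (z : V → ℝ) :
    z ⬝ᵥ (laplacian P π *ᵥ z) = -(1 / 2) * ∑ i, ∑ j, π i * P i j * (z i - z j) ^ 2 := by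
  have h1 : ∑ i, ∑ j, π i * P i j * (z i) ^ 2 = ∑ i, π i * z i ^ 2 := by
    refine Finset.sum_congr rfl fun i _ => ?_
    rw [← Finset.sum_mul, ← Finset.mul_sum, sum_row_of_mem_rowStochastic hP, mul_one]
  have h2 : ∑ i, ∑ j, π i * P i j * (z j) ^ 2 = ∑ i, π i * z i ^ 2 := by
    rw [Finset.sum_comm]
    refine Finset.sum_congr rfl fun j _ => ?_
    have hj : π j = ∑ k, π k * P k j := (congrFun hπ.invariant j).symm
    rw [← Finset.sum_mul, ← hj]
  have h3 : z ⬝ᵥ (laplacian P π *ᵥ z) =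
      ∑ i, ∑ j, π i * P i j * (z i * z j) - ∑ i, π i * z i ^ 2 := by
    simp only [dotProduct, laplacian_mulVec, ← Finset.sum_sub_distrib]
    refine Finset.sum_congr rfl fun i _ => ?_
    rw [mul_sub, mul_sub, Finset.mul_sum, Finset.mul_sum]
    congr 1
    · exact Finset.sum_congr rfl fun j _ => by ring
    · ring
  have h4 : ∑ i, ∑ j, π i * P i j * (z i - z j) ^ 2 =
      ∑ i, ∑ j, π i * P i j * (z i) ^ 2 - 2 * ∑ i, ∑ j, π i * P i j * (z i * z j)
        + ∑ i, ∑ j, π i * P i j * (z j) ^ 2 := by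
    simp only [Finset.mul_sum, ← Finset.sum_sub_distrib, ← Finset.sum_add_distrib]
    exact Finset.sum_congr rfl fun i _ => Finset.sum_congr rfl fun j _ => by ring
  rw [h3, h4, h1, h2]
  ring

theorem removeState_mulVec (M : Matrix V V ℝ) (a : V) (x : {i // i ≠ a} → ℝ) {z : V → ℝ}
    (hz : ∀ i : {i // i ≠ a}, z i = x i) (i : {i // i ≠ a}) :
    (M *ᵥ z) i = M i a * z a + (removeState M a *ᵥ x) i := by
  simp only [mulVec, dotProduct]
  rw [Fintype.sum_eq_add_sum_subtype_ne _ a]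
  simp [hz, removeState]

/-- Extended by zero at `a`, a vector of zero Dirichlet energy is constant along every transition of
positive probability, hence zero by irreducibility. -/
theorem neg_removeState_pos {P : Matrix V V ℝ} (hP : P ∈ rowStochastic ℝ V)
    (hirr : P.IsIrreducible) {π : V → ℝ} (hπ : IsStationary P π) (a : V)
    (x : {i // i ≠ a} → ℝ) (hx : x ≠ 0) :
    0 < x ⬝ᵥ (-removeState (laplacian P π) a) *ᵥ x := by
  set z : V → ℝ := fun i => if h : i = a then 0 else x ⟨i, h⟩ with hz
  have hza : z a = 0 := by simp [hz]
  have hzx : ∀ i : {i // i ≠ a}, z i = x i := fun i => by simp [hz, i.2]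
  have heq : x ⬝ᵥ (-removeState (laplacian P π) a) *ᵥ x =
      (1 / 2) * ∑ i, ∑ j, π i * P i j * (z i - z j) ^ 2 := by
    have h := dotProduct_laplacian_mulVec hP hπ z
    have h' : z ⬝ᵥ (laplacian P π *ᵥ z) = x ⬝ᵥ removeState (laplacian P π) a *ᵥ x := by
      rw [dotProduct, Fintype.sum_eq_add_sum_subtype_ne _ a, hza, zero_mul, zero_add]
      simp only [dotProduct]
      refine Finset.sum_congr rfl fun i _ => ?_
      rw [removeState_mulVec _ a x hzx i, hza, mul_zero, zero_add, hzx]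
    rw [neg_mulVec, dotProduct_neg, ← h', h]
    ring
  have hnn : ∀ i j, 0 ≤ π i * P i j * (z i - z j) ^ 2 := fun i j =>
    mul_nonneg (mul_nonneg (hπ.nonneg i) (hirr.nonneg i j)) (sq_nonneg _)
  rw [heq]
  by_contra! hle
  have h0 : ∑ i, ∑ j, π i * P i j * (z i - z j) ^ 2 = 0 :=
    le_antisymm (by linarith) (Finset.sum_nonneg fun i _ => Finset.sum_nonneg fun j _ => hnn i j)
  rw [Finset.sum_eq_zero_iff_of_nonneg fun i _ => Finset.sum_nonneg fun j _ => hnn i j] at h0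
  refine hx (funext fun i => ?_)
  rw [← hzx]
  refine forall_of_isIrreducible hirr (p := fun i => z i = 0) hza (fun i j hi hij => ?_) i
  have h1 := h0 i (Finset.mem_univ i)
  rw [Finset.sum_eq_zero_iff_of_nonneg fun j _ => hnn i j] at h1
  have h2 := h1 j (Finset.mem_univ j)
  have h3 : π i * P i j ≠ 0 := (mul_pos (hπ.pos hirr i) hij).ne'
  have h4 := (mul_eq_zero.mp h2).resolve_left h3
  have h5 : z i - z j = 0 := by simpa using h4
  linarith

/-- Ostrowski–Taussky for the Green's kernel, whose form at `x` is the energy of `A⁻¹ x`. -/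
theorem one_le_gammaRatio {P : Matrix V V ℝ} (hP : P ∈ rowStochastic ℝ V)
    (hirr : P.IsIrreducible) {π : V → ℝ} (hπ : IsStationary P π) (a : V) :
    1 ≤ gammaRatio (laplacian P π) a := by
  set A := -removeState (laplacian P π) a with hA
  have hApos := neg_removeState_pos hP hirr hπ a
  have hdet : IsUnit A.det := isUnit_iff_ne_zero.mpr (det_ne_zero_of_dotProduct_mulVec_pos hApos)
  have hG : ∀ x, x ≠ 0 → 0 < x ⬝ᵥ A⁻¹ *ᵥ x := by
    intro x hx
    have hx' : A *ᵥ (A⁻¹ *ᵥ x) = x := by rw [mulVec_mulVec, mul_nonsing_inv _ hdet, one_mulVec]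
    have hne : A⁻¹ *ᵥ x ≠ 0 := fun h => hx (by rw [← hx', h, mulVec_zero])
    have := hApos _ hne
    rwa [← hA, hx', dotProduct_comm] at this
  have h := det_add_transpose_le hG
  rw [gammaRatio, green, ← hA, le_div_iff₀ h.1, one_mul]
  exact h.2

theorem dotProduct_neg_symPart_mulVec (Q : Matrix V V ℝ) (a : V) (x : {i // i ≠ a} → ℝ) :
    x ⬝ᵥ (-symPart Q a) *ᵥ x = x ⬝ᵥ (-removeState Q a) *ᵥ x := by
  simp only [symPart, neg_mulVec, smul_mulVec, add_mulVec, dotProduct_neg, dotProduct_smul,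
    dotProduct_add, dotProduct_transpose_mulVec_self, smul_eq_mul]
  ring

/-- The energy sees only the symmetric part, and the factor 2 undoes the 1/2 in `sigmaSq`. -/
theorem sq_apply_le_sigmaSq {P : Matrix V V ℝ} (hP : P ∈ rowStochastic ℝ V)
    (hirr : P.IsIrreducible) {π : V → ℝ} (hπ : IsStationary P π) (a : V)
    (x : {i // i ≠ a} → ℝ) (i : {i // i ≠ a}) :
    0 < sigmaSq (laplacian P π) a ∧ x i ^ 2 ≤ 2 * sigmaSq (laplacian P π) a *
      (x ⬝ᵥ (-removeState (laplacian P π) a) *ᵥ x) := by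
  set S := -symPart (laplacian P π) a with hS
  have hSpos : ∀ x, x ≠ 0 → 0 < x ⬝ᵥ S *ᵥ x := fun x hx => by
    rw [dotProduct_neg_symPart_mulVec]
    exact neg_removeState_pos hP hirr hπ a x hx
  have hSt : Sᵀ = S := by
    rw [hS, symPart, transpose_neg, transpose_smul, transpose_add, transpose_transpose, add_comm]
  have h := sq_apply_le_inv_mul_dotProduct_mulVec hSt hSpos x i
  have hle : S⁻¹ i i ≤ 2 * sigmaSq (laplacian P π) a := by
    have : (1 / 2 : ℝ) * S⁻¹ i i ≤ sigmaSq (laplacian P π) a :=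
      le_ciSup (f := fun i : {i // i ≠ a} => ((1 / 2 : ℝ) • S⁻¹) i i)
        (Set.finite_range _).bddAbove i
    linarith
  have hnn : 0 ≤ x ⬝ᵥ S *ᵥ x := by
    rcases eq_or_ne x 0 with rfl | hx
    · simp
    · exact (hSpos x hx).le
  refine ⟨by linarith [h.1], ?_⟩
  rw [← dotProduct_neg_symPart_mulVec, ← hS]
  exact h.2.trans (mul_le_mul_of_nonneg_right hle hnn)

theorem sum_subtype_ne_eq {P : Matrix V V ℝ} {π : V → ℝ} (hπ : IsStationary P π) (a : V) :
    ∑ i : {i // i ≠ a}, π i = 1 - π a := by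
  have := hπ.sum_eq_one
  rw [Fintype.sum_eq_add_sum_subtype_ne _ a] at this
  linarith

theorem sum_mul_sq_le_sigmaSq {P : Matrix V V ℝ} (hP : P ∈ rowStochastic ℝ V)
    (hirr : P.IsIrreducible) {π : V → ℝ} (hπ : IsStationary P π) (a : V) [Nontrivial V]
    (x : {i // i ≠ a} → ℝ) :
    ∑ i : {i // i ≠ a}, π i * x i ^ 2 ≤ 2 * sigmaSq (laplacian P π) a *
      (x ⬝ᵥ (-removeState (laplacian P π) a) *ᵥ x) := by
  obtain ⟨b, hb⟩ := exists_ne a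
  set C := 2 * sigmaSq (laplacian P π) a *
      (x ⬝ᵥ (-removeState (laplacian P π) a) *ᵥ x) with hC
  have hx := fun i => (sq_apply_le_sigmaSq hP hirr hπ a x i).2
  have hC0 : 0 ≤ C := (sq_nonneg _).trans (hx ⟨b, hb⟩)
  calc ∑ i : {i // i ≠ a}, π i * x i ^ 2 ≤ ∑ i : {i // i ≠ a}, π i * C :=
        Finset.sum_le_sum fun i _ => mul_le_mul_of_nonneg_left (hx i) (hπ.nonneg _)
    _ = (1 - π a) * C := by rw [← Finset.sum_mul, sum_subtype_ne_eq hπ a]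
    _ ≤ C := by nlinarith [hπ.nonneg a]

/-- Solution of the Feynman–Kac eigenvalue problem `Q h + (θ π - β 1_a) h = 0`. -/
theorem exists_feynmanKac_solution {P : Matrix V V ℝ} (hP : P ∈ rowStochastic ℝ V)
    (hirr : P.IsIrreducible) {π : V → ℝ} (hπ : IsStationary P π) (a : V) [Nontrivial V]
    {θ : ℝ} (hθ : 0 ≤ θ) (hθσ : 2 * sigmaSq (laplacian P π) a * θ < 1) :
    ∃ (h : V → ℝ) (β : ℝ), h a = 1 ∧ (∀ i, 1 ≤ h i) ∧ 0 ≤ β ∧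
      β * (1 - 2 * sigmaSq (laplacian P π) a * θ) ≤ θ ∧
      ∀ i, (laplacian P π *ᵥ h) i + (θ * π i - if i = a then β else 0) * h i = 0 := by
  set s := sigmaSq (laplacian P π) a with hs
  obtain ⟨b, hb⟩ := exists_ne a
  have hs0 : 0 < s := (sq_apply_le_sigmaSq hP hirr hπ a 0 ⟨b, hb⟩).1
  set A := -removeState (laplacian P π) a with hA
  set π' : {i // i ≠ a} → ℝ := fun i => π i with hπ'
  -- With $h=1+\theta y$ off `a`, the equation there becomes $By=\pi$. The Poincaré inequality and
  -- $2s\theta<1$ make `B` coercive.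
  set B := A - θ • diagonal π' with hB
  have hw : ∀ x : {i // i ≠ a} → ℝ, x ⬝ᵥ diagonal π' *ᵥ x = ∑ i : {i // i ≠ a}, π i * x i ^ 2 := fun x => by
    simp only [dotProduct, mulVec_diagonal, hπ']
    exact Finset.sum_congr rfl fun i _ => by ring
  have hBx : ∀ x : {i // i ≠ a} → ℝ,
      x ⬝ᵥ B *ᵥ x = x ⬝ᵥ A *ᵥ x - θ * ∑ i : {i // i ≠ a}, π i * x i ^ 2 := fun x => by
    rw [hB, sub_mulVec, dotProduct_sub, smul_mulVec, dotProduct_smul, hw, smul_eq_mul]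
  have hAx := sum_mul_sq_le_sigmaSq hP hirr hπ a
  rw [← hA, ← hs] at hAx
  have hBpos : ∀ x, x ≠ 0 → 0 < x ⬝ᵥ B *ᵥ x := by
    intro x hx
    have h1 : 0 < x ⬝ᵥ A *ᵥ x := neg_removeState_pos hP hirr hπ a x hx
    have h2 := mul_le_mul_of_nonneg_left (hAx x) hθ
    rw [hBx]
    nlinarith
  have hdet : IsUnit B.det := isUnit_iff_ne_zero.mpr (det_ne_zero_of_dotProduct_mulVec_pos hBpos)
  set y := B⁻¹ *ᵥ π' with hy
  have hBy : B *ᵥ y = π' := by rw [hy, mulVec_mulVec, mul_nonsing_inv _ hdet, one_mulVec]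
  have hy0 : ∀ i, 0 ≤ y i := by
    refine nonneg_of_mulVec_nonneg hBpos (fun i j hij => ?_) fun i => ?_
    · have : (i : V) ≠ j := fun h => hij (Subtype.ext h)
      simp only [hB, hA, removeState, Matrix.sub_apply, Matrix.neg_apply, submatrix_apply,
        Matrix.smul_apply,
        diagonal_apply_ne _ hij, laplacian_apply, one_apply_ne this, smul_eq_mul]
      have := mul_nonneg (hπ.nonneg i) (hirr.nonneg i j)
      linarith
    · rw [hBy]; exact hπ.nonneg _
  have hAy : ∀ i, (A *ᵥ y) i = π i + θ * (π i * y i) := by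
    intro i
    have := congrFun hBy i
    rw [hB, sub_mulVec, smul_mulVec, Pi.sub_apply, Pi.smul_apply, mulVec_diagonal,
      smul_eq_mul] at this
    simp only [hπ'] at this
    linarith
  set e := ∑ i, π' i * y i with he
  have he0 : 0 ≤ e := Finset.sum_nonneg fun i _ => mul_nonneg (hπ.nonneg _) (hy0 i)
  have hesq : e ^ 2 ≤ ∑ i : {i // i ≠ a}, π i * y i ^ 2 := by
    have hcs := Finset.sum_sq_le_sum_mul_sum_of_sq_le_mul Finset.univ
      (f := fun i : {i // i ≠ a} => π i) (g := fun i => π i * y i ^ 2)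
      (r := fun i : {i // i ≠ a} => π i * y i)
      (fun i _ => hπ.nonneg _) (fun i _ => mul_nonneg (hπ.nonneg _) (sq_nonneg _))
      (fun i _ => le_of_eq (by ring))
    rw [sum_subtype_ne_eq hπ a] at hcs
    have hnn : 0 ≤ ∑ i : {i // i ≠ a}, π i * y i ^ 2 :=
      Finset.sum_nonneg fun i _ => mul_nonneg (hπ.nonneg _) (sq_nonneg _)
    have := hπ.nonneg a
    nlinarith
  -- Let $w=\sum\pi_i y_i^2$. The energy of `y` is $e+\theta w$, so Poincaré gives $w(1-2s\theta)\le
  -- 2se$; combine with $e^2\le w$ and divide by `e`.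
  have hebound : e * (1 - 2 * s * θ) ≤ 2 * s := by
    have h1 : e = y ⬝ᵥ A *ᵥ y - θ * ∑ i : {i // i ≠ a}, π i * y i ^ 2 := by
      rw [← hBx, hBy, dotProduct_comm]; rfl
    have h2 := hAx y
    set w := ∑ i : {i // i ≠ a}, π i * y i ^ 2
    have h3 : w * (1 - 2 * s * θ) ≤ 2 * s * e := by rw [h1]; nlinarith
    have h4 : e ^ 2 * (1 - 2 * s * θ) ≤ 2 * s * e :=
      (mul_le_mul_of_nonneg_right hesq (by linarith)).trans h3
    rcases eq_or_lt_of_le he0 with h | h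
    · rw [← h]; linarith
    · have : e * (e * (1 - 2 * s * θ)) ≤ e * (2 * s) := by nlinarith
      exact le_of_mul_le_mul_left this h
  set h : V → ℝ := fun i => if hi : i = a then 1 else 1 + θ * y ⟨i, hi⟩ with hh
  have hha : h a = 1 := by simp [hh]
  have hhi : ∀ i : {i // i ≠ a}, h i = (1 + θ • y) i := fun i => by simp [hh, i.2]
  have hQh : ∀ i : {i // i ≠ a}, (laplacian P π *ᵥ h) i = -(θ * (A *ᵥ y) i) := by
    intro i
    have h1 := removeState_mulVec (laplacian P π) a (1 + θ • y) hhi i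
    have h2 := removeState_mulVec (laplacian P π) a 1 (z := 1) (fun _ => rfl) i
    have h3 : (laplacian P π *ᵥ 1) i = 0 := by
      simpa [mulVec, dotProduct] using laplacian_sum_row hP π i
    rw [h3] at h2
    rw [h1, hha, mulVec_add, Pi.add_apply, mulVec_smul, Pi.smul_apply, hA, neg_mulVec,
      Pi.neg_apply, smul_eq_mul]
    simp only [Pi.one_apply] at h2
    linarith
  -- Stationarity makes the column sums vanish, which determines $(Qh)(a)$ from the other
  -- coordinates; the equation at `a` then forces $\beta=\theta+\theta^2e$.
  have hsumQh : ∑ i, (laplacian P π *ᵥ h) i = 0 := by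
    simp only [mulVec, dotProduct]
    rw [Finset.sum_comm]
    refine Finset.sum_eq_zero fun j _ => ?_
    rw [← Finset.sum_mul, laplacian_sum_col hπ, zero_mul]
  have hQa : (laplacian P π *ᵥ h) a = θ * (1 - π a) + θ ^ 2 * e := by
    rw [Fintype.sum_eq_add_sum_subtype_ne _ a] at hsumQh
    have : ∑ i : {i // i ≠ a}, (laplacian P π *ᵥ h) i = -(θ * (1 - π a) + θ ^ 2 * e) := by
      rw [← sum_subtype_ne_eq hπ a, he, Finset.mul_sum, Finset.mul_sum, ← Finset.sum_add_distrib,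
        ← Finset.sum_neg_distrib]
      refine Finset.sum_congr rfl fun i _ => ?_
      rw [hQh, hAy]
      ring
    linarith
  refine ⟨h, θ + θ ^ 2 * e, hha, fun i => ?_, by positivity, ?_, fun i => ?_⟩
  · by_cases hi : i = a
    · rw [hi, hha]
    · rw [hhi ⟨i, hi⟩]
      have := mul_nonneg hθ (hy0 ⟨i, hi⟩)
      simpa using this
  · have := mul_le_mul_of_nonneg_left hebound (sq_nonneg θ)
    nlinarith
  · by_cases hi : i = a
    · subst hi
      rw [hQa, hha, if_pos rfl]
      ring
    · rw [hQh ⟨i, hi⟩, hAy, if_neg hi, hhi ⟨i, hi⟩]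
      simp
      ring

end TailBound

/-! ### Discrete skeletons and their maximal inequality -/

namespace TailBound

open Filter Topology

variable {V : Type*} [Fintype V] [DecidableEq V]

section SemigroupDerivative

attribute [local instance] Matrix.linftyOpNormedRing Matrix.linftyOpNormedAlgebra

theorem hasDerivAt_exp_smul_apply (Q : Matrix V V ℝ) (i j : V) :
    HasDerivAt (fun u : ℝ => NormedSpace.exp (u • Q) i j) (Q i j) 0 := by
  have h := hasDerivAt_exp_smul_const (𝕂 := ℝ) Q 0
  rw [zero_smul, NormedSpace.exp_zero, one_mul] at h
  have := (LinearMap.toContinuousLinearMap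
    (Matrix.entryLinearMap ℝ ℝ i j : Matrix V V ℝ →ₗ[ℝ] ℝ)).hasFDerivAt.comp_hasDerivAt 0 h
  exact this

/-- Both sides agree at $\delta=0$, where the left side has derivative $(Qh+fh)(i)<0$. Strictness is
what makes the skeleton an exact supermartingale for small steps. -/
theorem eventually_exp_smul_le {Q : Matrix V V ℝ} {h f : V → ℝ}
    (hf : ∀ i, (Q.mulVec h) i + f i * h i < 0) :
    ∀ᶠ δ in 𝓝[>] (0 : ℝ), ∀ i,
      ∑ j, NormedSpace.exp (δ • Q) i j * (h j * Real.exp (δ * f j)) ≤ h i := by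
  refine eventually_all.mpr fun i => ?_
  have hd : HasDerivAt
      (fun δ : ℝ => ∑ j, NormedSpace.exp (δ • Q) i j * (h j * Real.exp (δ * f j)))
      ((Q.mulVec h) i + f i * h i) 0 := by
    have h1 : ∀ j, HasDerivAt (fun δ : ℝ => h j * Real.exp (δ * f j)) (h j * f j) 0 := fun j => by
      have h2 : HasDerivAt (fun δ : ℝ => δ * f j) (f j) 0 := by
        simpa using (hasDerivAt_id (0 : ℝ)).mul_const (f j)
      simpa using h2.exp.const_mul (h j)
    have h3 := HasDerivAt.fun_sum (u := Finset.univ)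
      fun j (_ : j ∈ Finset.univ) => (hasDerivAt_exp_smul_apply Q i j).mul (h1 j)
    refine h3.congr_deriv ?_
    simp [Finset.sum_add_distrib, Matrix.mulVec, dotProduct, Matrix.one_apply, mul_comm]
  have hval : ∑ j, NormedSpace.exp ((0 : ℝ) • Q) i j * (h j * Real.exp (0 * f j)) = h i := by
    simp [Matrix.one_apply]
  have hs := hd.tendsto_slope_zero_right.eventually (Iio_mem_nhds (hf i))
  filter_upwards [hs, self_mem_nhdsWithin] with δ hδ hδ0
  simp only [zero_add, hval, smul_eq_mul] at hδ
  have hδ0' : 0 < δ := hδ0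
  rw [inv_mul_lt_iff₀ hδ0', mul_zero] at hδ
  linarith

end SemigroupDerivative

section FiniteRange

variable {Ω : Type*} [MeasurableSpace Ω] {μ : Measure Ω} [IsProbabilityMeasure μ]

omit [MeasurableSpace Ω] in
theorem eq_sum_indicator {F : Type*} [Fintype F] (W : Ω → F) (Φ : F → ℝ) :
    (fun ω => Φ (W ω)) = fun ω => ∑ x, Set.indicator {ω | W ω = x} (fun _ => Φ x) ω := by
  classical
  funext ω
  simp [Set.indicator_apply]

theorem integrable_of_finite_range {F : Type*} [Fintype F] {W : Ω → F}
    (hW : ∀ x, MeasurableSet {ω | W ω = x}) (Φ : F → ℝ) : Integrable (fun ω => Φ (W ω)) μ := by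
  rw [eq_sum_indicator W Φ]
  exact integrable_finsetSum _ fun x _ => (integrable_const _).indicator (hW x)

theorem integral_of_finite_range {F : Type*} [Fintype F] {W : Ω → F}
    (hW : ∀ x, MeasurableSet {ω | W ω = x}) (Φ : F → ℝ) :
    ∫ ω, Φ (W ω) ∂μ = ∑ x, Φ x * μ.real {ω | W ω = x} := by
  rw [eq_sum_indicator W Φ, integral_finsetSum _ fun x _ =>
    (integrable_const _).indicator (hW x)]
  refine Finset.sum_congr rfl fun x _ => ?_
  rw [integral_indicator_const _ (hW x), smul_eq_mul, mul_comm]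

end FiniteRange

section Skeleton

variable {Ω : Type*} [MeasurableSpace Ω] {μ : Measure Ω} [IsProbabilityMeasure μ]
  {Q : Matrix V V ℝ} {a : V} {X : ℝ≥0 → Ω → V}

/-- The discrete skeleton of a process with time step `δ`. -/
def skeleton (X : ℝ≥0 → Ω → V) (δ : ℝ≥0) (ω : Ω) (k : ℕ) : V := X (k * δ) ω

/-- Extension of a finite path by its last value. -/
def extendPath {k : ℕ} (x : Fin (k + 1) → V) (n : ℕ) : V := x ⟨min n k, by omega⟩

/-- The first `k + 1` states of the skeleton. -/
def initialPath (X : ℝ≥0 → Ω → V) (δ : ℝ≥0) (k : ℕ) (ω : Ω) (j : Fin (k + 1)) : V :=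
  skeleton X δ ω j

omit [Fintype V] [DecidableEq V] [MeasurableSpace Ω] in
theorem apply_skeleton_eq {Φ : (ℕ → V) → ℝ} {k : ℕ} (hΦ : DependsOn Φ (Set.Iic k))
    (δ : ℝ≥0) (ω : Ω) :
    Φ (skeleton X δ ω) = Φ (extendPath (initialPath X δ k ω)) := by
  refine hΦ fun n hn => ?_
  simp only [extendPath, initialPath]
  rw [min_eq_left hn]

omit [IsProbabilityMeasure μ] in
theorem IsMarkovChain.measurableSet_initialPath (hX : IsMarkovChain μ Q a X) (δ : ℝ≥0) (k : ℕ)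
    (x : Fin (k + 1) → V) : MeasurableSet {ω | initialPath X δ k ω = x} := by
  have : {ω | initialPath X δ k ω = x} = ⋂ j : Fin (k + 1), {ω | X ((j : ℕ) * δ) ω = x j} := by
    ext ω
    simp [initialPath, skeleton, funext_iff]
  rw [this]
  exact MeasurableSet.iInter fun j => hX.measurableSet_eq _ _

theorem IsMarkovChain.integrable_skeleton (hX : IsMarkovChain μ Q a X) (δ : ℝ≥0)
    {Φ : (ℕ → V) → ℝ} {k : ℕ} (hΦ : DependsOn Φ (Set.Iic k)) :
    Integrable (fun ω => Φ (skeleton X δ ω)) μ := by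
  simp_rw [apply_skeleton_eq hΦ]
  exact integrable_of_finite_range (hX.measurableSet_initialPath δ k) fun x => Φ (extendPath x)

omit [IsProbabilityMeasure μ] in
-- The finite-dimensional laws for `k + 1` and `k` steps differ exactly by the last transition
-- factor.
theorem IsMarkovChain.measureReal_initialPath_and (hX : IsMarkovChain μ Q a X) (δ : ℝ≥0) (k : ℕ)
    (x : Fin (k + 1) → V) (v : V) :
    μ.real {ω | (initialPath X δ k ω, skeleton X δ ω (k + 1)) = (x, v)} =
      μ.real {ω | initialPath X δ k ω = x} *
        NormedSpace.exp ((δ : ℝ) • Q) (x (Fin.last k)) v := by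
  have hmono : ∀ m : ℕ, Monotone fun j : Fin (m + 1) => ((j : ℕ) : ℝ≥0) * δ := fun m i j hij => by
    have : ((i : ℕ) : ℝ≥0) ≤ (j : ℕ) := by exact_mod_cast hij
    exact mul_le_mul_of_nonneg_right this zero_le
  have hstep : ∀ n : ℕ, ((((n + 1 : ℕ) : ℝ≥0) * δ : ℝ≥0) : ℝ) - (((n : ℝ≥0) * δ : ℝ≥0) : ℝ) = δ :=
    fun n => by push_cast; ring
  have h1 := hX.finiteDimensional (k + 1) _ (hmono (k + 1)) (Fin.snoc (α := fun _ => V) x v)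
  have h2 := hX.finiteDimensional k _ (hmono k) x
  have e1 : {ω | (initialPath X δ k ω, skeleton X δ ω (k + 1)) = (x, v)} =
      {ω | ∀ j : Fin (k + 2), X ((j : ℕ) * δ) ω = Fin.snoc (α := fun _ => V) x v j} := by
    ext ω
    simp only [Set.mem_ofPred_eq, Prod.mk.injEq, Fin.forall_fin_succ', Fin.snoc_castSucc,
      Fin.snoc_last, funext_iff, initialPath, skeleton, Fin.val_castSucc, Fin.val_last]
  have e2 : {ω | initialPath X δ k ω = x} = {ω | ∀ j : Fin (k + 1), X ((j : ℕ) * δ) ω = x j} := by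
    ext ω
    simp [funext_iff, initialPath, skeleton]
  rw [e1, e2, h1, h2, Fin.prod_univ_castSucc, ← mul_assoc]
  simp only [Fin.val_succ, Fin.val_castSucc, hstep, Fin.succ_last, Fin.snoc_last,
    Fin.snoc_castSucc, Fin.val_last, Fin.val_zero]
  have e3 : (Fin.snoc (α := fun _ => V) x v 0 : V) = x 0 := by
    rw [← Fin.castSucc_zero, Fin.snoc_castSucc]
  rw [e3]
  congr 2
  refine Finset.prod_congr rfl fun j _ => ?_
  rw [Fin.succ_castSucc, Fin.snoc_castSucc]

/-- The Markov property of the skeleton. -/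
theorem IsMarkovChain.integral_mul_skeleton_succ (hX : IsMarkovChain μ Q a X) (δ : ℝ≥0)
    {Φ : (ℕ → V) → ℝ} {k : ℕ} (hΦ : DependsOn Φ (Set.Iic k)) (g : V → ℝ) :
    ∫ ω, Φ (skeleton X δ ω) * g (skeleton X δ ω (k + 1)) ∂μ =
      ∫ ω, Φ (skeleton X δ ω) *
        ∑ v, NormedSpace.exp ((δ : ℝ) • Q) (skeleton X δ ω k) v * g v ∂μ := by
  simp_rw [apply_skeleton_eq hΦ]
  have hmeas : ∀ p : (Fin (k + 1) → V) × V,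
      MeasurableSet {ω | (initialPath X δ k ω, skeleton X δ ω (k + 1)) = p} := by
    rintro ⟨x, v⟩
    have : {ω | (initialPath X δ k ω, skeleton X δ ω (k + 1)) = (x, v)} =
        {ω | initialPath X δ k ω = x} ∩ {ω | X ((k + 1 : ℕ) * δ) ω = v} := by
      ext ω; simp [skeleton]
    rw [this]
    exact (hX.measurableSet_initialPath δ k x).inter (hX.measurableSet_eq _ _)
  have h1 := integral_of_finite_range (μ := μ) hmeas fun p => Φ (extendPath p.1) * g p.2
  have h2 := integral_of_finite_range (μ := μ) (hX.measurableSet_initialPath δ k) fun x =>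
    Φ (extendPath x) * ∑ v, NormedSpace.exp ((δ : ℝ) • Q) (x (Fin.last k)) v * g v
  have h3 : ∀ ω, initialPath X δ k ω (Fin.last k) = skeleton X δ ω k := fun ω => rfl
  simp only [h3] at h2
  rw [h1, h2, Fintype.sum_prod_type]
  refine Finset.sum_congr rfl fun x _ => ?_
  simp only [hX.measureReal_initialPath_and, Finset.mul_sum, Finset.sum_mul]
  exact Finset.sum_congr rfl fun v _ => by ring

/-- The Feynman–Kac functional of a discrete path. -/
noncomputable def discreteFK (h f : V → ℝ) (δ : ℝ) (k : ℕ) (x : ℕ → V) : ℝ :=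
  h (x k) * Real.exp (δ * ∑ j ∈ Finset.range k, f (x (j + 1)))

omit [Fintype V] [DecidableEq V] in
theorem dependsOn_discreteFK (h f : V → ℝ) (δ : ℝ) (k : ℕ) :
    DependsOn (discreteFK h f δ k) (Set.Iic k) := by
  intro x y hxy
  unfold discreteFK
  rw [hxy k (Set.mem_Iic.mpr le_rfl)]
  congr 3
  refine Finset.sum_congr rfl fun j hj => ?_
  rw [hxy (j + 1) (Set.mem_Iic.mpr (Finset.mem_range.mp hj))]

open Classical in
/-- The Feynman–Kac functional, frozen at the level `c` once it has reached it. -/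
noncomputable def frozenFK (h f : V → ℝ) (δ c : ℝ) (k : ℕ) (x : ℕ → V) : ℝ :=
  if ∃ j ≤ k, c ≤ discreteFK h f δ j x then c else discreteFK h f δ k x

omit [Fintype V] [DecidableEq V] in
theorem dependsOn_exists_discreteFK (h f : V → ℝ) (δ c : ℝ) (k : ℕ) :
    DependsOn (fun x => ∃ j ≤ k, c ≤ discreteFK h f δ j x) (Set.Iic k) := by
  intro x y hxy
  have : ∀ j ≤ k, discreteFK h f δ j x = discreteFK h f δ j y := fun j hj =>
    dependsOn_discreteFK h f δ j fun i hi => hxy i (le_trans hi hj)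
  exact propext (exists_congr fun j => and_congr_right fun hj => by rw [this j hj])

omit [Fintype V] [DecidableEq V] in
theorem dependsOn_frozenFK (h f : V → ℝ) (δ c : ℝ) (k : ℕ) :
    DependsOn (frozenFK h f δ c k) (Set.Iic k) := by
  intro x y hxy
  have h1 := dependsOn_exists_discreteFK h f δ c k hxy
  simp only at h1
  simp only [frozenFK, h1, dependsOn_discreteFK h f δ k hxy]

/-- A supermartingale stopped on reaching `c` remains one, and replacing its value there by the
smaller `c` only helps. `Ψ` is the frozen part, and `Φ` the exponential weight of the paths still
running. -/
theorem IsMarkovChain.integral_frozenFK_succ_le (hX : IsMarkovChain μ Q a X) {δ : ℝ≥0}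
    {h f : V → ℝ} (hstep : ∀ i, ∑ j, NormedSpace.exp ((δ : ℝ) • Q) i j *
      (h j * Real.exp (δ * f j)) ≤ h i) (c : ℝ) (k : ℕ) :
    ∫ ω, frozenFK h f δ c (k + 1) (skeleton X δ ω) ∂μ ≤
      ∫ ω, frozenFK h f δ c k (skeleton X δ ω) ∂μ := by
  classical
  set E : (ℕ → V) → Prop := fun x => ∃ j ≤ k, c ≤ discreteFK h f δ j x with hE
  have hEd : DependsOn E (Set.Iic k) := dependsOn_exists_discreteFK h f δ c k
  set Φ : (ℕ → V) → ℝ := fun x =>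
    if E x then 0 else Real.exp (δ * ∑ j ∈ Finset.range k, f (x (j + 1))) with hΦ
  set Ψ : (ℕ → V) → ℝ := fun x => if E x then c else 0 with hΨ
  have hΨd : DependsOn Ψ (Set.Iic k) := fun x y hxy => by simp only [hΨ, hEd hxy]
  have hΦd : DependsOn Φ (Set.Iic k) := fun x y hxy => by
    have : ∑ j ∈ Finset.range k, f (x (j + 1)) = ∑ j ∈ Finset.range k, f (y (j + 1)) :=
      Finset.sum_congr rfl fun j hj => by
        rw [hxy (j + 1) (Set.mem_Iic.mpr (Finset.mem_range.mp hj))]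
    simp only [hΦ, hEd hxy, this]
  have hΦ0 : ∀ x, 0 ≤ Φ x := fun x => by
    simp only [hΦ]; split_ifs <;> positivity
  have hfr : ∀ x, frozenFK h f δ c k x = Ψ x + Φ x * h (x k) := fun x => by
    by_cases hx : E x
    · have e : frozenFK h f δ c k x = c := if_pos hx
      simp [e, hΨ, hΦ, hx]
    · have e : frozenFK h f δ c k x = discreteFK h f δ k x := if_neg hx
      simp [e, hΨ, hΦ, hx, discreteFK, mul_comm]
  have hfr' : ∀ x, frozenFK h f δ c (k + 1) x ≤
      Ψ x + Φ x * (h (x (k + 1)) * Real.exp (δ * f (x (k + 1)))) := fun x => by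
    simp only [frozenFK, hΨ, hΦ]
    by_cases hx : E x
    · have : ∃ j ≤ k + 1, c ≤ discreteFK h f δ j x := by
        obtain ⟨j, hj, hc⟩ := hx
        exact ⟨j, by omega, hc⟩
      rw [if_pos this, if_pos hx, if_pos hx]
      linarith
    · have heq : Real.exp (δ * ∑ j ∈ Finset.range k, f (x (j + 1))) *
          (h (x (k + 1)) * Real.exp (δ * f (x (k + 1)))) = discreteFK h f δ (k + 1) x := by
        rw [discreteFK, Finset.sum_range_succ, mul_add, Real.exp_add]
        ring
      rw [if_neg hx, if_neg hx, heq, zero_add]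
      split_ifs with h'
      · obtain ⟨j, hj, hc⟩ := h'
        rcases Nat.lt_or_ge k j with hkj | hkj
        · obtain rfl : j = k + 1 := by omega
          exact hc
        · exact absurd ⟨j, hkj, hc⟩ hx
      · exact le_rfl
  have hd1 : DependsOn (fun x : ℕ → V => Φ x * (h (x (k + 1)) * Real.exp (δ * f (x (k + 1)))))
      (Set.Iic (k + 1)) := fun x y hxy => by
    have h1 := hΦd fun i hi => hxy i (Set.mem_Iic.mpr (Nat.le_succ_of_le hi))
    have h2 := hxy (k + 1) (Set.mem_Iic.mpr le_rfl)
    simp only [h1, h2]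
  have hd2 : ∀ g : V → ℝ, DependsOn (fun x : ℕ → V => Φ x * g (x k)) (Set.Iic k) :=
    fun g x y hxy => by
      have h1 := hΦd hxy
      have h2 := hxy k (Set.mem_Iic.mpr le_rfl)
      simp only [h1, h2]
  have iΨ := hX.integrable_skeleton δ hΨd
  calc ∫ ω, frozenFK h f δ c (k + 1) (skeleton X δ ω) ∂μ
      ≤ ∫ ω, (Ψ (skeleton X δ ω) + Φ (skeleton X δ ω) *
          (h (skeleton X δ ω (k + 1)) * Real.exp (δ * f (skeleton X δ ω (k + 1))))) ∂μ :=
        integral_mono (hX.integrable_skeleton δ (dependsOn_frozenFK h f δ c (k + 1)))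
          (iΨ.add (hX.integrable_skeleton δ hd1)) fun ω => hfr' _
    _ = ∫ ω, Ψ (skeleton X δ ω) ∂μ + ∫ ω, Φ (skeleton X δ ω) *
          ∑ v, NormedSpace.exp ((δ : ℝ) • Q) (skeleton X δ ω k) v *
            (h v * Real.exp (δ * f v)) ∂μ := by
        rw [integral_add iΨ (hX.integrable_skeleton δ hd1),
          hX.integral_mul_skeleton_succ δ hΦd fun v => h v * Real.exp (δ * f v)]
    _ ≤ ∫ ω, Ψ (skeleton X δ ω) ∂μ + ∫ ω, Φ (skeleton X δ ω) * h (skeleton X δ ω k) ∂μ := by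
        gcongr
        · exact hX.integrable_skeleton δ (hd2 fun i => ∑ v, NormedSpace.exp ((δ : ℝ) • Q) i v *
            (h v * Real.exp (δ * f v)))
        · exact hX.integrable_skeleton δ (hd2 h)
        · exact fun ω => mul_le_mul_of_nonneg_left (hstep _) (hΦ0 _)
    _ = ∫ ω, frozenFK h f δ c k (skeleton X δ ω) ∂μ := by
        simp_rw [hfr]
        rw [integral_add iΨ (hX.integrable_skeleton δ (hd2 h))]

/-- Ville's maximal inequality for the skeleton. -/
theorem IsMarkovChain.measureReal_exists_discreteFK_le (hX : IsMarkovChain μ Q a X) {δ : ℝ≥0}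
    {h f : V → ℝ} (hh : ∀ i, 0 ≤ h i) (hstep : ∀ i, ∑ j, NormedSpace.exp ((δ : ℝ) • Q) i j *
      (h j * Real.exp (δ * f j)) ≤ h i) {c : ℝ} (N : ℕ) :
    c * μ.real {ω | ∃ k ≤ N, c ≤ discreteFK h f δ k (skeleton X δ ω)} ≤ h a := by
  classical
  have h0 : ∫ ω, frozenFK h f δ c 0 (skeleton X δ ω) ∂μ ≤ h a := by
    have : ∀ᵐ ω ∂μ, frozenFK h f δ c 0 (skeleton X δ ω) ≤ h a := by
      filter_upwards [hX.start] with ω hω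
      have h1 : discreteFK h f δ 0 (skeleton X δ ω) = h a := by
        simp [discreteFK, skeleton, hω]
      simp only [frozenFK, nonpos_iff_eq_zero, exists_eq_left, h1]
      split_ifs with h2
      · exact h2
      · exact le_rfl
    calc ∫ ω, frozenFK h f δ c 0 (skeleton X δ ω) ∂μ ≤ ∫ _ω, h a ∂μ :=
          integral_mono_ae (hX.integrable_skeleton δ (dependsOn_frozenFK h f δ c 0))
            (integrable_const _) this
      _ = h a := by simp
  have hN : ∫ ω, frozenFK h f δ c N (skeleton X δ ω) ∂μ ≤ h a := by
    induction N with
    | zero => exact h0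
    | succ k ih => exact (hX.integral_frozenFK_succ_le hstep c k).trans ih
  set Ψ : (ℕ → V) → ℝ := fun x => if ∃ k ≤ N, c ≤ discreteFK h f δ k x then 1 else 0 with hΨ
  have hΨd : DependsOn Ψ (Set.Iic N) := fun x y hxy => by
    have := dependsOn_exists_discreteFK h f δ c N hxy
    simp only at this
    simp only [hΨ, this]
  have hmeas : MeasurableSet {ω | ∃ k ≤ N, c ≤ discreteFK h f δ k (skeleton X δ ω)} := by
    have hd : ∀ k, {ω | c ≤ discreteFK h f δ k (skeleton X δ ω)} =
        ⋃ x ∈ {x : Fin (k + 1) → V | c ≤ discreteFK h f δ k (extendPath x)},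
          {ω | initialPath X δ k ω = x} := fun k => by
      ext ω
      simp [apply_skeleton_eq (dependsOn_discreteFK h f δ k)]
    have : {ω | ∃ k ≤ N, c ≤ discreteFK h f δ k (skeleton X δ ω)} =
        ⋃ k ∈ Set.Iic N, {ω | c ≤ discreteFK h f δ k (skeleton X δ ω)} := by
      ext ω; simp
    rw [this]
    refine MeasurableSet.biUnion (Set.to_countable _) fun k _ => ?_
    rw [hd]
    exact MeasurableSet.biUnion (Set.to_countable _) fun x _ =>
      hX.measurableSet_initialPath δ k x
  refine le_trans ?_ hN
  have h2 : c * μ.real {ω | ∃ k ≤ N, c ≤ discreteFK h f δ k (skeleton X δ ω)} =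
      ∫ ω, c * Ψ (skeleton X δ ω) ∂μ := by
    rw [integral_const_mul]
    congr 1
    rw [← integral_indicator_one hmeas]
    congr 1
    funext ω
    simp only [hΨ, Set.indicator_apply, Set.mem_ofPred_eq, Pi.one_apply]
  rw [h2]
  refine integral_mono ((hX.integrable_skeleton δ hΨd).const_mul c)
    (hX.integrable_skeleton δ (dependsOn_frozenFK h f δ c N)) fun ω => ?_
  simp only [hΨ, frozenFK]
  split_ifs with h3
  · simp
  · rw [mul_zero, discreteFK]
    exact mul_nonneg (hh _) (Real.exp_pos _).le

end Skeleton

end TailBound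

/-! ### From skeletons to right-continuous paths -/

namespace TailBound

open Filter Topology

section Path

variable {V : Type*} {x : ℝ≥0 → V}

theorem toNNReal_le_natCeil_mul {δ : ℝ≥0} (hδ : 0 < δ) (s : ℝ) :
    s.toNNReal ≤ ⌈s / δ⌉₊ * δ ∧ (⌈s / δ⌉₊ : ℝ≥0) * δ ≤ s.toNNReal + δ := by
  have hδ' : (0 : ℝ) < δ := hδ
  rcases le_total s 0 with hs | hs
  · have : ⌈s / δ⌉₊ = 0 := Nat.ceil_eq_zero.mpr (div_nonpos_of_nonpos_of_nonneg hs hδ'.le)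
    simp [this, Real.toNNReal_of_nonpos hs]
  · have h1 : s / δ ≤ ⌈s / δ⌉₊ := Nat.le_ceil _
    have h2 : (⌈s / δ⌉₊ : ℝ) < s / δ + 1 := Nat.ceil_lt_add_one (div_nonneg hs hδ'.le)
    rw [div_le_iff₀ hδ'] at h1
    have h3 : (⌈s / δ⌉₊ : ℝ) * δ ≤ s + δ := by
      have := mul_le_mul_of_nonneg_right h2.le hδ'.le
      rwa [add_mul, div_mul_cancel₀ _ hδ'.ne', one_mul] at this
    constructor
    · rw [← NNReal.coe_le_coe, Real.coe_toNNReal _ hs]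
      push_cast
      exact h1
    · rw [← NNReal.coe_le_coe]
      push_cast
      rw [Real.coe_toNNReal _ hs]
      exact h3

/-- A right-continuous path in a discrete space agrees eventually with its right-endpoint
discretizations. -/
theorem eventually_natCeil_mul_eq (hx : ∀ t, ∀ᶠ s in 𝓝[≥] t, x s = x t) {δ : ℕ → ℝ≥0}
    (hδ0 : ∀ m, 0 < δ m) (hδ : Tendsto δ atTop (𝓝 0)) (s : ℝ) :
    ∀ᶠ m in atTop, x (⌈s / δ m⌉₊ * δ m) = x s.toNNReal := by
  have hlim : Tendsto (fun m => (⌈s / δ m⌉₊ : ℝ≥0) * δ m) atTop (𝓝[≥] s.toNNReal) := by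
    refine tendsto_nhdsWithin_iff.mpr ⟨?_, Eventually.of_forall fun m =>
      (toNNReal_le_natCeil_mul (hδ0 m) s).1⟩
    refine tendsto_of_tendsto_of_tendsto_of_le_of_le (g := fun _ => s.toNNReal)
      (h := fun m => s.toNNReal + δ m) tendsto_const_nhds ?_
      (fun m => (toNNReal_le_natCeil_mul (hδ0 m) s).1)
      (fun m => (toNNReal_le_natCeil_mul (hδ0 m) s).2)
    simpa using tendsto_const_nhds.add hδ
  exact hlim.eventually (hx s.toNNReal)

theorem measurable_natCeil_mul (φ : V → ℝ) (x : ℝ≥0 → V) (δ : ℝ≥0) :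
    Measurable fun s : ℝ => φ (x (⌈s / δ⌉₊ * δ)) := by
  have h1 : Measurable fun n : ℕ => φ (x (n * δ)) := measurable_from_nat
  exact h1.comp (Nat.measurable_ceil.comp (measurable_id.div_const _))

/-- The meshes used for the discretizations. -/
noncomputable def mesh (m : ℕ) : ℝ≥0 := 1 / ((m : ℝ≥0) + 1) ^ 2

theorem mesh_pos (m : ℕ) : 0 < mesh m := by unfold mesh; positivity

theorem tendsto_mesh : Tendsto mesh atTop (𝓝 0) := by
  have h := (tendsto_one_div_add_atTop_nhds_zero_nat (𝕜 := ℝ≥0)).pow 2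
  simp only [ne_eq, OfNat.ofNat_ne_zero, not_false_eq_true, zero_pow] at h
  refine h.congr fun m => ?_
  rw [mesh, div_pow, one_pow]

theorem measurable_path (hx : ∀ t, ∀ᶠ s in 𝓝[≥] t, x s = x t) (φ : V → ℝ) :
    Measurable fun s : ℝ => φ (x s.toNNReal) := by
  refine measurable_of_tendsto_metrizable (fun m => measurable_natCeil_mul φ x (mesh m))
    (tendsto_pi_nhds.mpr fun s => ?_)
  refine tendsto_const_nhds.congr' ?_
  filter_upwards [eventually_natCeil_mul_eq hx mesh_pos tendsto_mesh s] with m hm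
  rw [hm]

variable [Finite V]

theorem exists_forall_abs_le (φ : V → ℝ) : ∃ C, 0 ≤ C ∧ ∀ v, |φ v| ≤ C := by
  obtain ⟨C, hC⟩ := (Set.finite_range fun v => |φ v|).bddAbove
  exact ⟨max C 0, le_max_right _ _, fun v => (hC ⟨v, rfl⟩).trans (le_max_left _ _)⟩

theorem intervalIntegrable_of_measurable_path {y : ℝ → V} {φ : V → ℝ}
    (hy : Measurable fun s => φ (y s)) (b c : ℝ) :
    IntervalIntegrable (fun s => φ (y s)) volume b c := by
  obtain ⟨C, -, hC⟩ := exists_forall_abs_le φ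
  exact (intervalIntegrable_const (c := C)).mono_fun hy.aestronglyMeasurable
    (ae_of_all _ fun s => (hC _).trans (le_abs_self C))

theorem integral_natCeil_mul (φ : V → ℝ) (x : ℝ≥0 → V) {δ : ℝ≥0} (hδ : 0 < δ) (k : ℕ) :
    ∫ s in (0 : ℝ)..(k * δ), φ (x (⌈s / δ⌉₊ * δ)) =
      δ * ∑ j ∈ Finset.range k, φ (x ((j + 1 : ℕ) * δ)) := by
  have hδ' : (0 : ℝ) < δ := hδ
  have hsum := intervalIntegral.sum_integral_adjacent_intervals (n := k) (μ := volume)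
    (f := fun s : ℝ => φ (x (⌈s / δ⌉₊ * δ))) (a := fun j : ℕ => (j : ℝ) * δ)
    fun j _ => intervalIntegrable_of_measurable_path
      (y := fun s : ℝ => x (⌈s / δ⌉₊ * δ)) (measurable_natCeil_mul φ x δ) _ _
  simp only [Nat.cast_zero, zero_mul] at hsum
  rw [← hsum, Finset.mul_sum]
  refine Finset.sum_congr rfl fun j _ => ?_
  have hle : (j : ℝ) * δ ≤ (j + 1 : ℕ) * δ := by
    push_cast; nlinarith
  have hcongr : ∫ s in ((j : ℝ) * δ)..((j + 1 : ℕ) * δ), φ (x (⌈s / δ⌉₊ * δ)) =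
      ∫ _s in ((j : ℝ) * δ)..((j + 1 : ℕ) * δ), φ (x ((j + 1 : ℕ) * δ)) := by
    rw [intervalIntegral.integral_of_le hle, intervalIntegral.integral_of_le hle]
    refine setIntegral_congr_fun measurableSet_Ioc fun s hs => ?_
    have : ⌈s / δ⌉₊ = j + 1 := by
      rw [Nat.ceil_eq_iff (by omega)]
      rw [lt_div_iff₀ hδ', div_le_iff₀ hδ']
      exact ⟨by simpa using hs.1, hs.2⟩
    simp only [this]
  rw [hcongr, intervalIntegral.integral_const, smul_eq_mul]
  push_cast
  ring

/-- Dominated convergence on $[0,t]$; rounding the endpoint up adds an interval of length at most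
$\delta_m$, contributing at most $C\delta_m$. -/
theorem tendsto_integral_natCeil_mul (hx : ∀ t, ∀ᶠ s in 𝓝[≥] t, x s = x t) (φ : V → ℝ)
    {δ : ℕ → ℝ≥0} (hδ0 : ∀ m, 0 < δ m) (hδ : Tendsto δ atTop (𝓝 0)) (t : ℝ≥0) :
    Tendsto (fun m => ∫ s in (0 : ℝ)..(⌈(t : ℝ) / δ m⌉₊ * δ m), φ (x (⌈s / δ m⌉₊ * δ m))) atTop
      (𝓝 (∫ s in (0 : ℝ)..t, φ (x s.toNNReal))) := by
  obtain ⟨C, hC0, hC⟩ := exists_forall_abs_le φ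
  have hint : ∀ m b c, IntervalIntegrable (fun s : ℝ => φ (x (⌈s / δ m⌉₊ * δ m))) volume b c :=
    fun m => intervalIntegrable_of_measurable_path (y := fun s : ℝ => x (⌈s / δ m⌉₊ * δ m))
      (measurable_natCeil_mul φ x (δ m))
  have h1 : Tendsto (fun m => ∫ s in (0 : ℝ)..t, φ (x (⌈s / δ m⌉₊ * δ m))) atTop
      (𝓝 (∫ s in (0 : ℝ)..t, φ (x s.toNNReal))) := by
    refine intervalIntegral.tendsto_integral_filter_of_dominated_convergence (fun _ => C)
      (Eventually.of_forall fun m => (measurable_natCeil_mul φ x (δ m)).aestronglyMeasurable)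
      (Eventually.of_forall fun m => ae_of_all _ fun s _ => hC _) intervalIntegrable_const
      (ae_of_all _ fun s _ => tendsto_const_nhds.congr' ?_)
    filter_upwards [eventually_natCeil_mul_eq hx hδ0 hδ s] with m hm
    rw [hm]
  have h2 : Tendsto (fun m => ∫ s in (t : ℝ)..(⌈(t : ℝ) / δ m⌉₊ * δ m),
      φ (x (⌈s / δ m⌉₊ * δ m))) atTop (𝓝 0) := by
    have hδr : Tendsto (fun m => C * (δ m : ℝ)) atTop (𝓝 0) := by
      have : Tendsto (fun m => (δ m : ℝ)) atTop (𝓝 0) := by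
        rw [← NNReal.coe_zero]
        exact NNReal.tendsto_coe.mpr hδ
      simpa using this.const_mul C
    refine squeeze_zero_norm (fun m => ?_) hδr
    refine (intervalIntegral.norm_integral_le_of_norm_le_const (C := C) fun s _ => hC _).trans ?_
    have h3 := toNNReal_le_natCeil_mul (hδ0 m) t
    rw [Real.toNNReal_coe] at h3
    have h4 : (t : ℝ) ≤ ⌈(t : ℝ) / δ m⌉₊ * δ m := by exact_mod_cast h3.1
    have h5 : (⌈(t : ℝ) / δ m⌉₊ : ℝ) * δ m ≤ t + δ m := by exact_mod_cast h3.2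
    rw [abs_of_nonneg (by linarith)]
    exact mul_le_mul_of_nonneg_left (by linarith) hC0
  have h3 := h1.add h2
  rw [add_zero] at h3
  refine h3.congr fun m => ?_
  exact intervalIntegral.integral_add_adjacent_intervals (hint m _ _) (hint m _ _)

end Path

section Ville

variable {V : Type*} [Fintype V] [DecidableEq V] {Ω : Type*} [MeasurableSpace Ω] {μ : Measure Ω}
  [IsProbabilityMeasure μ] {Q : Matrix V V ℝ} {a : V} {X : ℝ≥0 → Ω → V}

/-- The Feynman–Kac functional `h(X_t) exp (∫_0^t f(X_s) ds)`. -/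
noncomputable def pathFK (h f : V → ℝ) (X : ℝ≥0 → Ω → V) (t : ℝ≥0) (ω : Ω) : ℝ :=
  h (X t ω) * Real.exp (∫ s in (0 : ℝ)..t, f (X s.toNNReal ω))

/-- $(m+1)^3$ steps of size $(m+1)^{-2}$ reach time $m+1$, so the horizon grows while the mesh
shrinks. -/
theorem eventually_natCeil_div_mesh_le (t : ℝ≥0) :
    ∀ᶠ m in atTop, ⌈(t : ℝ) / mesh m⌉₊ ≤ (m + 1) ^ 3 := by
  filter_upwards [eventually_ge_atTop ⌈(t : ℝ)⌉₊] with m hm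
  rw [Nat.ceil_le]
  have h1 : (t : ℝ) ≤ m := (Nat.le_ceil _).trans (by exact_mod_cast hm)
  have h2 : (t : ℝ) / mesh m = t * ((m : ℝ) + 1) ^ 2 := by
    simp [mesh, div_eq_mul_inv]
  rw [h2]
  push_cast
  have : (t : ℝ) ≤ m + 1 := by linarith
  calc (t : ℝ) * ((m : ℝ) + 1) ^ 2 ≤ (m + 1) * ((m : ℝ) + 1) ^ 2 := by gcongr
    _ = ((m : ℝ) + 1) ^ 3 := by ring

omit [DecidableEq V] [MeasurableSpace Ω] in
theorem eventually_discreteFK_ge {ω : Ω} (hx : ∀ t, ∀ᶠ s in 𝓝[≥] t, X s ω = X t ω)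
    {h f : V → ℝ} {c : ℝ} {t : ℝ≥0} (hc : c < pathFK h f X t ω) :
    ∀ᶠ m in atTop, ∃ k ≤ (m + 1) ^ 3, c ≤ discreteFK h f (mesh m) k (skeleton X (mesh m) ω) := by
  have h1 := tendsto_integral_natCeil_mul hx f mesh_pos tendsto_mesh t
  have h2 : Tendsto (fun m => h (X t ω) * Real.exp (∫ s in (0 : ℝ)..(⌈(t : ℝ) / mesh m⌉₊ * mesh m),
      f (X (⌈s / mesh m⌉₊ * mesh m) ω))) atTop (𝓝 (pathFK h f X t ω)) :=
    ((Real.continuous_exp.tendsto _).comp h1).const_mul _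
  filter_upwards [h2.eventually (lt_mem_nhds hc), eventually_natCeil_div_mesh_le t,
    eventually_natCeil_mul_eq hx mesh_pos tendsto_mesh t] with m hm1 hm2 hm3
  refine ⟨_, hm2, ?_⟩
  rw [Real.toNNReal_coe] at hm3
  rw [integral_natCeil_mul f (fun s => X s ω) (mesh_pos m)] at hm1
  rw [discreteFK]
  simp only [skeleton]
  rw [hm3]
  exact hm1.le

/-- Ville's maximal inequality for a Feynman–Kac functional. -/
theorem IsMarkovChain.measure_exists_pathFK_le (hX : IsMarkovChain μ Q a X) {h f : V → ℝ}
    (hh : ∀ i, 0 ≤ h i) (hf : ∀ i, (Q.mulVec h) i + f i * h i < 0) {c : ℝ} (hc : 0 < c) :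
    μ {ω | ∃ t, c < pathFK h f X t ω} ≤ ENNReal.ofReal (h a / c) := by
  set B : ℕ → Set Ω := fun m =>
    {ω | ∃ k ≤ (m + 1) ^ 3, c ≤ discreteFK h f (mesh m) k (skeleton X (mesh m) ω)} with hB
  have hstep : ∀ᶠ m in atTop, ∀ i, ∑ j, NormedSpace.exp ((mesh m : ℝ) • Q) i j *
      (h j * Real.exp (mesh m * f j)) ≤ h i := by
    have : Tendsto (fun m => (mesh m : ℝ)) atTop (𝓝[>] 0) := by
      refine tendsto_nhdsWithin_iff.mpr ⟨?_, Eventually.of_forall fun m => mesh_pos m⟩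
      rw [← NNReal.coe_zero]
      exact NNReal.tendsto_coe.mpr tendsto_mesh
    exact this.eventually (eventually_exp_smul_le hf)
  obtain ⟨m₀, hm₀⟩ := eventually_atTop.mp hstep
  have hBm : ∀ m ≥ m₀, μ (B m) ≤ ENNReal.ofReal (h a / c) := fun m hm => by
    have h1 := hX.measureReal_exists_discreteFK_le hh (hm₀ m hm) (c := c) ((m + 1) ^ 3)
    rw [← ofReal_measureReal (μ := μ) (s := B m)]
    refine ENNReal.ofReal_le_ofReal ?_
    rw [le_div_iff₀ hc, mul_comm]
    exact h1
  -- A crossing is seen by all fine enough skeletons, so the event lies in the limit inferior of the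
  -- `B m`, whose measure inherits their uniform bound.
  have hsub : {ω | ∃ t, c < pathFK h f X t ω} ⊆ ⋃ m, ⋂ k ≥ m, B k := by
    rintro ω ⟨t, ht⟩
    obtain ⟨m, hm⟩ := eventually_atTop.mp (eventually_discreteFK_ge (hX.rightContinuous ω) ht)
    exact Set.mem_iUnion.mpr ⟨m, Set.mem_iInter₂.mpr hm⟩
  have hmono : Monotone fun m => ⋂ k ≥ m, B k := fun m m' hmm' =>
    Set.biInter_subset_biInter_left fun k hk => le_trans hmm' hk
  refine (measure_mono hsub).trans ?_
  rw [hmono.measure_iUnion]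
  refine iSup_le fun m => ?_
  exact (measure_mono (Set.iInter₂_subset (max m m₀) (le_max_left _ _))).trans
    (hBm _ (le_max_right _ _))

end Ville

end TailBound

/-! ### Local times and the exponential bound -/

namespace TailBound

open Filter Topology

section LocalTime

variable {V : Type*} [Fintype V] [DecidableEq V] {Ω : Type*} {X : ℝ≥0 → Ω → V} {ω : Ω}

omit [DecidableEq V] in
theorem intervalIntegrable_path (hx : ∀ t, ∀ᶠ s in 𝓝[≥] t, X s ω = X t ω) (φ : V → ℝ) (b c : ℝ) :
    IntervalIntegrable (fun s : ℝ => φ (X s.toNNReal ω)) volume b c :=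
  intervalIntegrable_of_measurable_path (y := fun s : ℝ => X s.toNNReal ω)
    (measurable_path (x := fun s => X s ω) hx φ) b c

theorem continuous_localTime (hx : ∀ t, ∀ᶠ s in 𝓝[≥] t, X s ω = X t ω) (i : V) :
    Continuous fun t => localTime X i t ω :=
  intervalIntegral.continuous_primitive
    (fun b c => intervalIntegrable_path hx (fun v => if v = i then (1 : ℝ) else 0) b c) 0

/-- The occupation time formula. -/
theorem integral_eq_sum_localTime (hx : ∀ t, ∀ᶠ s in 𝓝[≥] t, X s ω = X t ω) (φ : V → ℝ) (t : ℝ) :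
    ∫ s in (0 : ℝ)..t, φ (X s.toNNReal ω) = ∑ i, φ i * localTime X i t ω := by
  simp only [localTime]
  simp_rw [← intervalIntegral.integral_const_mul]
  rw [← intervalIntegral.integral_finsetSum fun i _ =>
    (intervalIntegrable_path hx (fun v => if v = i then (1 : ℝ) else 0) 0 t).const_mul (φ i)]
  simp

omit [Fintype V] in
theorem localTime_nonneg (X : ℝ≥0 → Ω → V) (i : V) {t : ℝ} (ht : 0 ≤ t) (ω : Ω) :
    0 ≤ localTime X i t ω :=
  intervalIntegral.integral_nonneg ht fun s _ => by split_ifs <;> norm_num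

theorem sum_localTime (hx : ∀ t, ∀ᶠ s in 𝓝[≥] t, X s ω = X t ω) (t : ℝ) :
    ∑ i, localTime X i t ω = t := by
  have := integral_eq_sum_localTime hx (fun _ => 1) t
  simpa using this.symm

theorem localTime_invLocalTime_le (hx : ∀ t, ∀ᶠ s in 𝓝[≥] t, X s ω = X t ω) (a : V) {r : ℝ}
    (hr : 0 ≤ r) :
    0 ≤ invLocalTime X a r ω ∧ localTime X a (invLocalTime X a r ω) ω ≤ r := by
  have h0 : 0 ≤ invLocalTime X a r ω := Real.sInf_nonneg fun t ht => ht.1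
  refine ⟨h0, ?_⟩
  by_contra! hlt
  set τ := invLocalTime X a r ω with hτ
  -- The case `τ = 0` also covers an empty set of times, for which `sInf` is `0`.
  have hτ0 : 0 < τ := by
    rcases eq_or_lt_of_le h0 with h | h
    · rw [← h] at hlt
      simp only [localTime, intervalIntegral.integral_same] at hlt
      linarith
    · exact h
  have hnear := (continuous_localTime hx a).continuousAt.eventually (lt_mem_nhds hlt)
  obtain ⟨t, ht, ht'⟩ := ((hnear.filter_mono nhdsWithin_le_nhds).and
    (Ioo_mem_nhdsLT hτ0)).exists
  have hbdd : BddBelow {t : ℝ | 0 ≤ t ∧ r < localTime X a t ω} := ⟨0, fun t ht => ht.1⟩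
  have : τ ≤ t := csInf_le hbdd ⟨ht'.1.le, ht⟩
  linarith [ht'.2]

end LocalTime

section Exponential

variable {V : Type*} [Fintype V] [DecidableEq V] [Nontrivial V] {Ω : Type*} [MeasurableSpace Ω]
  {μ : Measure Ω} [IsProbabilityMeasure μ] {P : Matrix V V ℝ} {π : V → ℝ} {a : V}
  {X : ℝ≥0 → Ω → V}

/-- Subtracting `ε` turns the Feynman–Kac equation into the strict inequality needed for Ville. Here
`h ≥ 1` lets the factor $h(X_t)$ be dropped and `h a = 1` fixes the constant. -/
theorem IsMarkovChain.exists_measure_localTime_le (hP : P ∈ Matrix.rowStochastic ℝ V)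
    (hirr : P.IsIrreducible) (hπ : IsStationary P π)
    (hX : IsMarkovChain μ (laplacian P π) a X) {θ : ℝ} (hθ : 0 ≤ θ)
    (hθσ : 2 * sigmaSq (laplacian P π) a * θ < 1) :
    ∃ β : ℝ, 0 ≤ β ∧ β * (1 - 2 * sigmaSq (laplacian P π) a * θ) ≤ θ ∧ ∀ ε > 0, ∀ u : ℝ,
      μ {ω | ∃ t : ℝ, 0 ≤ t ∧
        u < (θ - ε) * ∑ i, π i * localTime X i t ω - β * localTime X a t ω} ≤
      ENNReal.ofReal (Real.exp (-u)) := by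
  obtain ⟨h, β, ha, h1, hβ, hβθ, heq⟩ := exists_feynmanKac_solution hP hirr hπ a hθ hθσ
  refine ⟨β, hβ, hβθ, fun ε hε u => ?_⟩
  set f : V → ℝ := fun i => (θ - ε) * π i - if i = a then β else 0 with hf
  have hneg : ∀ i, ((laplacian P π).mulVec h) i + f i * h i < 0 := fun i => by
    have h2 := heq i
    have h3 : 0 < ε * π i * h i :=
      mul_pos (mul_pos hε (hπ.pos hirr i)) (zero_lt_one.trans_le (h1 i))
    simp only [hf]
    linarith
  have hV := hX.measure_exists_pathFK_le (fun i => zero_le_one.trans (h1 i)) hneg (Real.exp_pos u)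
  rw [ha, one_div, ← Real.exp_neg] at hV
  refine (measure_mono ?_).trans hV
  rintro ω ⟨t, ht, hu⟩
  refine ⟨t.toNNReal, ?_⟩
  have hint : ∫ s in (0 : ℝ)..t.toNNReal, f (X s.toNNReal ω) =
      (θ - ε) * ∑ i, π i * localTime X i t ω - β * localTime X a t ω := by
    rw [integral_eq_sum_localTime (hX.rightContinuous ω), Real.coe_toNNReal _ ht]
    simp [hf, sub_mul, Finset.sum_sub_distrib, Finset.mul_sum, mul_assoc]
  rw [pathFK, hint]
  calc Real.exp u < Real.exp _ := Real.exp_lt_exp.mpr hu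
    _ ≤ _ := le_mul_of_one_le_left (Real.exp_pos _).le (h1 _)

theorem IsMarkovChain.ae_exists_lt_localTime (hP : P ∈ Matrix.rowStochastic ℝ V)
    (hirr : P.IsIrreducible) (hπ : IsStationary P π)
    (hX : IsMarkovChain μ (laplacian P π) a X) (r : ℝ) :
    ∀ᵐ ω ∂μ, ∃ t : ℝ, 0 ≤ t ∧ r < localTime X a t ω := by
  obtain ⟨b, hb⟩ := exists_ne a
  have hσ : 0 < sigmaSq (laplacian P π) a := (sq_apply_le_sigmaSq hP hirr hπ a 0 ⟨b, hb⟩).1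
  set v := sigmaSq (laplacian P π) a with hv
  -- This choice gives $2v\theta=1/2$; half of it is later spent as `ε`, leaving the coefficient
  -- `η`.
  have hθ : 0 < 1 / (4 * v) := by positivity
  obtain ⟨β, hβ, -, hμ⟩ := hX.exists_measure_localTime_le hP hirr hπ hθ.le (by
    rw [← hv]; field_simp; norm_num)
  set η := 1 / (4 * v) / 2 with hη
  have hη0 : 0 < η := by positivity
  obtain ⟨j, hj⟩ := Finite.exists_min π
  have hπj : 0 < π j := hπ.pos hirr j
  have hle : ∀ u : ℝ, μ {ω | ¬ ∃ t : ℝ, 0 ≤ t ∧ r < localTime X a t ω} ≤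
      ENNReal.ofReal (Real.exp (-u)) := fun u => by
    refine (measure_mono ?_).trans (hμ η hη0 u)
    intro ω hω
    have hω' : ∀ t : ℝ, 0 ≤ t → localTime X a t ω ≤ r := fun t ht => by
      by_contra! hlt
      exact hω ⟨t, ht, hlt⟩
    have hlim : Tendsto (fun t : ℝ => η * (π j * t) - β * r) atTop atTop :=
      tendsto_atTop_add_const_right _ _ ((tendsto_id.const_mul_atTop hπj).const_mul_atTop hη0)
    obtain ⟨t, ht0, ht⟩ := ((eventually_ge_atTop 0).and (hlim.eventually_gt_atTop u)).exists
    refine ⟨t, ht0, ht.trans_le ?_⟩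
    have h1 : π j * t ≤ ∑ i, π i * localTime X i t ω := by
      conv_lhs => rw [← sum_localTime (hX.rightContinuous ω) t]
      rw [Finset.mul_sum]
      exact Finset.sum_le_sum fun i _ =>
        mul_le_mul_of_nonneg_right (hj i) (localTime_nonneg X i ht0 ω)
    have h2 : 1 / (4 * v) - η = η := by rw [hη]; ring
    rw [h2]
    have h3 := mul_le_mul_of_nonneg_left h1 hη0.le
    have h4 := mul_le_mul_of_nonneg_left (hω' t ht0) hβ
    linarith
  have hlim : Tendsto (fun u : ℝ => ENNReal.ofReal (Real.exp (-u))) atTop (𝓝 0) := by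
    have := ENNReal.tendsto_ofReal (Real.tendsto_exp_neg_atTop_nhds_zero)
    simpa using this
  exact le_antisymm (ge_of_tendsto' hlim hle) zero_le

/-- The optimal $\theta=s/(2v(p+s))$ would give $l/2$ but has $2v\theta=1$ when $p=0$. Using $p+2s$
keeps $2v\theta<1$ and yields $\frac l2\cdot\frac{p^2+3ps+s^2}{(p+s)(p+2s)}\ge\frac l4$. -/
theorem chernoff_exponent {p s v l θ β : ℝ} (hp : 0 ≤ p) (hs : 0 < s) (hv : 0 < v)
    (hl : s ^ 2 = l * v) (hθ : θ = s / ((p + 2 * s) * (2 * v)))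
    (hβ : β * (1 - 2 * v * θ) ≤ θ) : l / 4 ≤ θ * (p + s) ^ 2 - β * p ^ 2 := by
  have hD : 0 < p + 2 * s := by positivity
  have hE : 0 < p + s := by positivity
  have hl0 : 0 < l := by
    have : 0 < l * v := by rw [← hl]; positivity
    exact pos_of_mul_pos_left this hv.le
  have h1 : 1 - 2 * v * θ = (p + s) / (p + 2 * s) := by rw [hθ]; field_simp; ring
  have h2 : β * (p + s) ≤ θ * (p + 2 * s) := by
    rw [h1, mul_div_assoc', div_le_iff₀ hD] at hβ
    exact hβ
  have h3 : θ * s * (p + 2 * s) = l / 2 := by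
    have : l = s ^ 2 / v := by rw [hl]; field_simp
    rw [hθ, this]; field_simp
  have h4 : l / 4 * ((p + s) * (p + 2 * s)) ≤
      (θ * (p + s) ^ 2 - β * p ^ 2) * ((p + s) * (p + 2 * s)) := by
    have h5 := mul_le_mul_of_nonneg_right h2 (mul_nonneg (sq_nonneg p) hD.le)
    have h6 : θ * s * (p + 2 * s) * (p ^ 2 + 3 * p * s + s ^ 2) =
        l / 2 * (p ^ 2 + 3 * p * s + s ^ 2) := by rw [h3]
    have h7 : 0 ≤ l * p ^ 2 := by positivity
    have h8 : 0 ≤ l * (p * s) := by positivity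
    nlinarith
  exact le_of_mul_le_mul_right h4 (mul_pos hE hD)

theorem IsMarkovChain.measureReal_sqrt_sub_sqrt_ge_le (hP : P ∈ Matrix.rowStochastic ℝ V)
    (hirr : P.IsIrreducible) (hπ : IsStationary P π)
    (hX : IsMarkovChain μ (laplacian P π) a X) {r : ℝ} (hr : 0 ≤ r) {l : ℝ} (hl : 0 < l) :
    μ.real {ω | Real.sqrt (∑ i, π i * localTime X i (invLocalTime X a r ω) ω) - Real.sqrt r
      ≥ Real.sqrt l * Real.sqrt (sigmaSq (laplacian P π) a)} ≤ Real.exp (-l / 8) := by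
  obtain ⟨b, hb⟩ := exists_ne a
  have hσ : 0 < sigmaSq (laplacian P π) a := (sq_apply_le_sigmaSq hP hirr hπ a 0 ⟨b, hb⟩).1
  set v := sigmaSq (laplacian P π) a with hv
  set p := Real.sqrt r with hp
  set s := Real.sqrt l * Real.sqrt v with hs
  have hp0 : 0 ≤ p := Real.sqrt_nonneg r
  have hs0 : 0 < s := mul_pos (Real.sqrt_pos.mpr hl) (Real.sqrt_pos.mpr hσ)
  have hs2 : s ^ 2 = l * v := by rw [hs, mul_pow, Real.sq_sqrt hl.le, Real.sq_sqrt hσ.le]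
  have hp2 : p ^ 2 = r := Real.sq_sqrt hr
  obtain ⟨θ, hθ⟩ : ∃ θ, θ = s / ((p + 2 * s) * (2 * v)) := ⟨_, rfl⟩
  have hθ0 : 0 ≤ θ := by rw [hθ]; positivity
  have hθσ : 2 * v * θ < 1 := by
    have : 2 * v * θ = s / (p + 2 * s) := by rw [hθ]; field_simp
    rw [this, div_lt_one (by positivity)]
    linarith
  obtain ⟨β, hβ, hβθ, hμ⟩ := hX.exists_measure_localTime_le hP hirr hπ hθ0 hθσ
  have hexp := chernoff_exponent hp0 hs0 hσ hs2 hθ hβθ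
  set c := (p + s) ^ 2 with hc
  have hc0 : 0 < c := by positivity
  rw [hp2] at hexp
  -- The perturbation costs $\varepsilon c=l/16$, so $l/4-l/16$ still strictly exceeds $l/8$; it
  -- also keeps $\theta-\varepsilon\ge0$, since $\theta c\ge l/4$.
  set ε := l / (16 * c) with hε
  have hε0 : 0 < ε := by positivity
  have hεc : ε * c = l / 16 := by rw [hε]; field_simp
  have hεθ : ε ≤ θ := by
    refine le_of_mul_le_mul_right ?_ hc0
    have := mul_nonneg hβ hr
    linarith
  refine ENNReal.toReal_le_of_le_ofReal (Real.exp_pos _).le ?_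
  rw [neg_div]
  refine le_trans (measure_mono ?_) (hμ ε hε0 (l / 8))
  intro ω hω
  have hω' : p + s ≤ Real.sqrt (∑ i, π i * localTime X i (invLocalTime X a r ω) ω) := by
    have : Real.sqrt (∑ i, π i * localTime X i (invLocalTime X a r ω) ω) - p ≥ s := hω
    linarith
  obtain ⟨hτ, hLa⟩ := localTime_invLocalTime_le (hX.rightContinuous ω) a hr
  refine ⟨invLocalTime X a r ω, hτ, ?_⟩
  have hT : c ≤ ∑ i, π i * localTime X i (invLocalTime X a r ω) ω :=
    (Real.le_sqrt' (by positivity)).mp hω'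
  have h1 := mul_le_mul_of_nonneg_left hT (sub_nonneg.mpr hεθ)
  have h2 := mul_le_mul_of_nonneg_left hLa hβ
  linarith

end Exponential

end TailBound

/-- Tail bound for the `π`-weighted total local time at the inverse local time `τ_inv(r)`. The
first part says that `τ_inv(r)` is almost surely finite, so that the infimum defining it is
almost surely over a nonempty set. -/
theorem lemma5p1 {n : ℕ} (hn : 2 ≤ n)
    (P : Matrix (Fin n) (Fin n) ℝ) (hP : P ∈ Matrix.rowStochastic ℝ (Fin n))
    (hirr : P.IsIrreducible)
    (π : Fin n → ℝ) (hπ : TailBound.IsStationary P π)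
    (a : Fin n)
    {Ω : Type*} [MeasurableSpace Ω] (μ : MeasureTheory.Measure Ω)
    [MeasureTheory.IsProbabilityMeasure μ]
    (X : NNReal → Ω → Fin n)
    (hX : TailBound.IsMarkovChain μ (TailBound.laplacian P π) a X)
    (r : ℝ) (hr : 0 ≤ r) :
    (∀ᵐ ω ∂μ, ∃ t : ℝ, 0 ≤ t ∧ r < TailBound.localTime X a t ω) ∧
    ∀ l : ℝ, 0 < l →
      μ.real {ω |
          Real.sqrt (∑ i, π i *
              TailBound.localTime X i (TailBound.invLocalTime X a r ω) ω) - Real.sqrt r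
            ≥ Real.sqrt l * Real.sqrt (TailBound.sigmaSq (TailBound.laplacian P π) a)}
        ≤ 5 * TailBound.gammaRatio (TailBound.laplacian P π) a * Real.exp (-l / 8) := by
  have : Nontrivial (Fin n) := Fin.nontrivial_iff_two_le.mpr hn
  refine ⟨hX.ae_exists_lt_localTime hP hirr hπ r, fun l hl => ?_⟩
  refine (hX.measureReal_sqrt_sub_sqrt_ge_le hP hirr hπ hr hl).trans ?_
  have hγ := TailBound.one_le_gammaRatio hP hirr hπ a
  exact le_mul_of_one_le_left (Real.exp_pos _).le (by linarith)
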